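/- Let $N\ge 3$, $\mathcal V=\{1,\dots,N\}$, let $G_1,\dots,G_q$ be undirected simple graphs on $\mathcal V$ with Laplacian matrices $\mathsf L_1,\dots,\mathsf L_q$, and let $\sigma:\mathbb R_{\ge0}\to\{1,\dots,q\}$ be a right-continuous piecewise constant switching signal with finitely many switches in every bounded time interval. Let $Q\in\mathbb R^{(N-1)\times N}$ satisfy $Q\mathbf 1=0$, $QQ^\top=I$, $Q^\top Q=I-\frac1N\mathbf 1\mathbf 1^\top$, and assume that the network is $(\mu,T)$-PE connected for some $T>0$, $\mu\in(0,N]$, i.e. $\frac1T\int_t^{t+T}Q\mathsf L_{\sigma(\tau)}Q^\top d\tau\ge\mu I_{N-1}$ for all $t\ge0$. For gains $\alpha,\gamma>0$, a set $\mathcal A\subseteq\mathcal V$ of malicious agents and an attack signal $u_{\mathcal A}\in\mathcal L_{pe}$ ($1\le p\le\infty$) with values in $\mathbb R^{|\mathcal A|}$, let $x=\mathrm{col}(\tilde p,v)$ be a solution for $t\ge t_0\ge0$ of $$\dot{\tilde p}=v,\qquad \dot v=-\alpha\mathsf L_{\sigma(t)}\tilde p-\gamma v+I_{\mathcal A}u_{\mathcal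 A},$$ where the columns of $I_{\mathcal A}\in\mathbb R^{N\times|\mathcal A|}$ are the canonical vectors of the agents in $\mathcal A$. For an agent $i$ and the graph $G=G_{\sigma(t)}$ with Laplacian $\mathsf L$, let $V'$ consist of $i$ and its neighbours, let $V''\supseteq V'$ contain in addition the nodes joined to $i$ by a path of length $2$, and let $S=V''\setminus V'$, $\mathcal R=\mathcal V\setminus V''$. Let $\mathsf L^{(23)}$ be the block of $\mathsf L$ with rows in $S$ and columns in $\mathcal R$, and let $\tilde{\tilde{\mathsf L}}$ be the $S\times S$ block of the Laplacian of the graph formed by the edges of $G$ within $S$ and between $S$ and $\mathcal R$. The coupling term $\rho$ between the $2$-hop subsystem of $i$ (the states of the agents in $V''$) and the rest of the network is the vector in $\mathbb R^{2|V''|}$ whose velocity entries in $S$ are $-\alpha\big(\tilde{\tilde{\mathsf L}}\tilde p_{S}+\mathsf L^{(23)}\tilde p_{\mathcal R}\big)$ and whose other entries are $0$. For $\beta>0$ put, with Euclidean and induced matrix norms, $$\eta=-\tfrac1{2T}\ln\Big(1-\tfrac{(\alpha/\gamma)\mu T}{1+(\alpha/\gamma)^2N^2T^2}\Big),\quad \lambda_\chi=\eta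 e^{-2\eta T},\quad 0<\lambda_x<\lambda_\chi,\quad C=\begin{bmatrix}\frac1\gamma I&-\frac1\gamma Q\\0&I\end{bmatrix},$$ $$\kappa_x=\|C\|\sqrt{\frac{\max\{\lambda_\chi^{-1},\beta\}}{\min\{\frac{\gamma}{\alpha N},\beta\}}}\,\|C^{-1}\|,\qquad \kappa_u=\|C\|\frac{\max\{\lambda_\chi^{-1},\beta\}}{\lambda_x\min\{\frac{\gamma}{2\alpha N},\frac\beta2\}}.$$ Then for every sufficiently large control gain, i.e. for all $\gamma\ge\gamma_0$ with some $\gamma_0>0$ depending only on $N,\alpha,\mu,T$, the following holds for all data as above (all $\beta>0$ and $0<\lambda_x<\lambda_\chi$, and all choices of $Q$, network, $\mathcal A$, $u_{\mathcal A}$, $t_0$, solution $x$ and agent $i$). For every $T_d$ with $\sup_{t_0\le s\le T_d}\|u_{\mathcal A}(s)\|<\infty$, $$\|\rho(t)\|\le\alpha\kappa_xe^{-\lambda_x(t-t_0)}\|x(t_0)\|+\alpha\kappa_u\sup_{t_0\le s\le T_d}\|u_{\mathcal A}(s)\|\qquad\text{for all } t_0\le t\le T_d.$$ If moreover $\mathcal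 A=\emptyset$, then $\|\rho(t)\|\le\alpha\kappa_xe^{-\lambda_x(t-t_0)}\|x(t_0)\|$ for all $t\ge t_0$; in particular $\rho(t)$ converges exponentially to $0$. -/

import Mathlib

open Matrix MeasureTheory Set Filter Topology
open scoped ENNReal

noncomputable section

namespace MultiAgent

variable {N : ℕ}

/-! ### Graphs, hop neighbourhoods and Laplacian blocks -/

open Classical in
/-- The Laplacian matrix (degree matrix minus adjacency matrix) of an undirected graph. -/
def lap (G : SimpleGraph (Fin N)) : Matrix (Fin N) (Fin N) ℝ := G.lapMatrix ℝ

open Classical in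
/-- The `k`-hop neighbours of `i`: the nodes joined to `i` by a path of length `k`. -/
def hop (G : SimpleGraph (Fin N)) (k : ℕ) (i : Fin N) : Finset (Fin N) :=
  Finset.univ.filter fun j => ∃ w : G.Walk i j, w.IsPath ∧ w.length = k

/-- Node set of the 1-hop proximity graph: `i` and its 1-hop neighbours. -/
def V1 (G : SimpleGraph (Fin N)) (i : Fin N) : Finset (Fin N) := {i} ∪ hop G 1 i

/-- Node set of the 2-hop proximity graph. -/
def V2 (G : SimpleGraph (Fin N)) (i : Fin N) : Finset (Fin N) := V1 G i ∪ hop G 2 i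

/-- The second block of the partition of the nodes: the nodes of the 2-hop proximity graph
that do not already lie in the first block `V1 G i`. -/
def S2 (G : SimpleGraph (Fin N)) (i : Fin N) : Finset (Fin N) := V2 G i \ V1 G i

/-- The rest of the network. -/
def R (G : SimpleGraph (Fin N)) (i : Fin N) : Finset (Fin N) := Finset.univ \ V2 G i

/-- The edges of `G` between nodes of `S2 G i`, and those between `S2 G i` and `R G i`. -/
def outerGraph (G : SimpleGraph (Fin N)) (i : Fin N) : SimpleGraph (Fin N) where
  Adj a b := G.Adj a b ∧
    ((a ∈ S2 G i ∧ b ∈ S2 G i) ∨ (a ∈ S2 G i ∧ b ∈ R G i) ∨ (a ∈ R G i ∧ b ∈ S2 G i))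
  symm := ⟨fun a b h => ⟨h.1.symm, by tauto⟩⟩
  loopless := ⟨fun a h => G.loopless.irrefl a h.1⟩

/-- The part of the diagonal block `L⁽²²⁾` that encodes the edges of `outerGraph G i`. -/
def lapOuter (G : SimpleGraph (Fin N)) (i : Fin N) : Matrix (S2 G i) (S2 G i) ℝ :=
  (lap (outerGraph G i)).submatrix Subtype.val Subtype.val

/-- The block `L⁽²³⁾` of the Laplacian of `G`. -/
def lap23 (G : SimpleGraph (Fin N)) (i : Fin N) : Matrix (S2 G i) (R G i) ℝ :=
  (lap G).submatrix Subtype.val Subtype.val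

/-- Index type of the agents of the 2-hop subsystem, first `V1 G i`, then `S2 G i`. -/
abbrev I (G : SimpleGraph (Fin N)) (i : Fin N) : Type := V1 G i ⊕ S2 G i

/-! ### The network dynamics -/

/-- The system matrix `[0, I; -α L, -γ I]` of the closed loop in the mode with graph `G`,
acting on `x = col (p̃, v)`. -/
def sysA (α γ : ℝ) (G : SimpleGraph (Fin N)) : Matrix (Fin N ⊕ Fin N) (Fin N ⊕ Fin N) ℝ :=
  Matrix.fromBlocks 0 1 (-(α • lap G)) (-(γ • (1 : Matrix (Fin N) (Fin N) ℝ)))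

/-- The input matrix `[0; I_𝒜]`, the columns of `I_𝒜` being the canonical vectors of the
malicious agents. -/
def sysB (𝒜 : Finset (Fin N)) : Matrix (Fin N ⊕ Fin N) 𝒜 ℝ :=
  Matrix.fromRows 0 ((1 : Matrix (Fin N) (Fin N) ℝ).submatrix id Subtype.val)

/-- `x` is a (Carathéodory) solution on `[t₀, ∞)` of the switched system
`ẋ = A_{σ(t)} x + B_𝒜 u_𝒜`. -/
def IsTrajectory {q : ℕ} (α γ : ℝ) (G : Fin q → SimpleGraph (Fin N)) (σ : ℝ → Fin q)
    (𝒜 : Finset (Fin N)) (u : ℝ → EuclideanSpace ℝ 𝒜) (t₀ : ℝ)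
    (x : ℝ → EuclideanSpace ℝ (Fin N ⊕ Fin N)) : Prop :=
  ContinuousOn x (Ici t₀) ∧ ∀ t, t₀ ≤ t →
    x t = x t₀ + ∫ s in t₀..t,
      WithLp.toLp 2 (sysA α γ (G (σ s)) *ᵥ (x s).ofLp + sysB 𝒜 *ᵥ (u s).ofLp)

/-- The extended space `ℒ_{pe}`: every truncation to `[0, T_d]` is in `ℒ_p`. -/
def MemLpe {E : Type*} [NormedAddCommGroup E] (p : ℝ≥0∞) (u : ℝ → E) : Prop :=
  ∀ Td : ℝ, 0 ≤ Td → MemLp u p (volume.restrict (Icc 0 Td))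

/-- On `[0, ∞)` the signal is piecewise constant and right-continuous, with finitely many
switches in each bounded interval `[t₀, t₀ + T)`. -/
def FiniteSwitching {q : ℕ} (σ : ℝ → Fin q) : Prop :=
  ∀ t₀ T : ℝ, 0 ≤ t₀ → 0 < T → ∃ (m : ℕ) (τ : ℕ → ℝ), τ 0 = t₀ ∧ τ (m + 1) = t₀ + T ∧
    ∀ k ≤ m, τ k < τ (k + 1) ∧ ∀ s ∈ Ico (τ k) (τ (k + 1)), σ s = σ (τ k)

/-- `Q 1 = 0`, `Q Qᵀ = I`, `Qᵀ Q = I - (1/N) 1 1ᵀ`. -/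
def IsReduction (Q : Matrix (Fin (N - 1)) (Fin N) ℝ) : Prop :=
  Q *ᵥ (fun _ => 1) = 0 ∧ Q * Qᵀ = 1 ∧
    Qᵀ * Q = 1 - (1 / (N : ℝ)) • Matrix.of (fun _ _ => (1 : ℝ))

/-- `(μ, T)`-PE connectivity:
`(1/T) ∫_t^{t+T} Q L_{σ(τ)} Qᵀ dτ ≥ μ I` (Loewner order) for all `t ≥ 0`. -/
def PEConnected {q : ℕ} (G : Fin q → SimpleGraph (Fin N)) (σ : ℝ → Fin q)
    (Q : Matrix (Fin (N - 1)) (Fin N) ℝ) (μ T : ℝ) : Prop :=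
  ∀ t : ℝ, 0 ≤ t →
    (Matrix.of (fun a b => (1 / T) * ∫ τ in t..(t + T), (Q * lap (G (σ τ)) * Qᵀ) a b)
      - μ • (1 : Matrix (Fin (N - 1)) (Fin (N - 1)) ℝ)).PosSemidef

/-! ### The coupling term -/

/-- The states `col (p̃_ℐ, v_ℐ)` of the 2-hop subsystem of agent `i`. -/
def stateI (G : SimpleGraph (Fin N)) (i : Fin N) (x : EuclideanSpace ℝ (Fin N ⊕ Fin N)) :
    EuclideanSpace ℝ (I G i ⊕ I G i) :=
  WithLp.toLp 2 fun k =>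
    x.ofLp (Sum.map (Sum.elim Subtype.val Subtype.val) (Sum.elim Subtype.val Subtype.val) k)

/-- The states `col (p̃_ℛ, v_ℛ)` of the rest of the network. -/
def stateR (G : SimpleGraph (Fin N)) (i : Fin N) (x : EuclideanSpace ℝ (Fin N ⊕ Fin N)) :
    EuclideanSpace ℝ (R G i ⊕ R G i) :=
  WithLp.toLp 2 fun k => x.ofLp (Sum.map Subtype.val Subtype.val k)

/-- The unknown part of the system matrix of the 2-hop subsystem. -/
def outerA (α : ℝ) (G : SimpleGraph (Fin N)) (i : Fin N) :
    Matrix (I G i ⊕ I G i) (I G i ⊕ I G i) ℝ :=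
  Matrix.fromBlocks 0 0 (Matrix.fromBlocks 0 0 0 (-(α • lapOuter G i))) 0

/-- The coupling matrix from the rest of the network to the 2-hop subsystem. -/
def couplingA (α : ℝ) (G : SimpleGraph (Fin N)) (i : Fin N) :
    Matrix (I G i ⊕ I G i) (R G i ⊕ R G i) ℝ :=
  Matrix.fromBlocks 0 0 (Matrix.fromRows 0 (-(α • lap23 G i))) 0

/-- The coupling term `ρ(x_ℐ, x_ℛ)`. -/
def rho (α : ℝ) (G : SimpleGraph (Fin N)) (i : Fin N)
    (xI : EuclideanSpace ℝ (I G i ⊕ I G i)) (xR : EuclideanSpace ℝ (R G i ⊕ R G i)) :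
    EuclideanSpace ℝ (I G i ⊕ I G i) :=
  WithLp.toLp 2 (outerA α G i *ᵥ xI.ofLp + couplingA α G i *ᵥ xR.ofLp)

/-! ### The constants of the bound -/

/-- `η = -(1/2T) ln (1 - (α/γ) μ T / (1 + (α/γ)² N² T²))`. -/
def eta (N : ℕ) (α γ μ T : ℝ) : ℝ :=
  -(1 / (2 * T)) *
    Real.log (1 - ((α / γ) * μ * T) / (1 + (α / γ) ^ 2 * (N : ℝ) ^ 2 * T ^ 2))

/-- `λ_χ = η e^{-2 η T}`. -/
def lamChi (N : ℕ) (α γ μ T : ℝ) : ℝ :=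
  eta N α γ μ T * Real.exp (-2 * eta N α γ μ T * T)

/-- `C = [(1/γ) I, -(1/γ) Q; 0, I]`. -/
def matC (γ : ℝ) (Q : Matrix (Fin (N - 1)) (Fin N) ℝ) :
    Matrix (Fin (N - 1) ⊕ Fin N) (Fin (N - 1) ⊕ Fin N) ℝ :=
  Matrix.fromBlocks ((1 / γ) • 1) (-((1 / γ) • Q)) 0 1

/-- The matrix norm induced by the Euclidean vector norm. -/
def opNorm {ι : Type*} [Fintype ι] [DecidableEq ι] (M : Matrix ι ι ℝ) : ℝ :=
  ‖Matrix.toEuclideanCLM (n := ι) (𝕜 := ℝ) M‖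

/-- `κ_x`. -/
def kappaX (α γ μ T β : ℝ) (Q : Matrix (Fin (N - 1)) (Fin N) ℝ) : ℝ :=
  opNorm (matC γ Q) *
    Real.sqrt (max (lamChi N α γ μ T)⁻¹ β / min (γ / (α * N)) β) * opNorm ((matC γ Q)⁻¹)

/-- `κ_u`. -/
def kappaU (α γ μ T β lamX : ℝ) (Q : Matrix (Fin (N - 1)) (Fin N) ℝ) : ℝ :=
  opNorm (matC γ Q) *
    (max (lamChi N α γ μ T)⁻¹ β / (lamX * min (γ / (2 * α * N)) (β / 2)))

end MultiAgent

end

/-!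
The agents' states are split into `χ = γ Q p̃ + Q v` and `v`. With `ε = α / γ` the dynamics become
`χ' = -ε M(t) χ + ε Q L v + Q I_𝒜 u` and `v' = -γ v - ε L Qᵀ χ + ε L v + I_𝒜 u`, where
`M(t) = Q L_{σ(t)} Qᵀ` is persistently exciting: for small `ε` the first equation is slow
and contracts on average at rate `ε μ` at least, while the second is strongly damped.

The Lyapunov function is `U = ‖χ‖² - (2ε/T) ⟪χ, P(t) χ⟫ + ‖v‖²` with the averaging weight
`P(t) = ∫_t^{t+T} (t + T - r) M(r) dr` (`windowWeight`). Since `P' = ∫_t^{t+T} M - T M(t)`, the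
correction term replaces the merely semidefinite `-2ε ⟪χ, M(t) χ⟫` by `-(2ε/T) ⟪χ, (∫ M) χ⟫`, which
is at most `-2ε μ ‖χ‖²`; everything else is of higher order in `1/γ`, absorbed by the damping of
`v`, or due to the attack. This gives
`U' ≤ -ε μ U + 10 b² / (ε μ)`, with `b` a bound of `‖u‖`, for large `γ` and almost every
time, and Grönwall's inequality for absolutely continuous functions applies
(`norm_sq_add_norm_sq_le_of_persistently_exciting`).

The rate fits because `λ_χ ≤ ε μ / 2` (`MultiAgent.lamChi_le`). The constants fit for large `γ`:
`ρ` is `-α` times a Laplacian applied to `p̃`, so `‖ρ‖` is at most a constant times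
`‖Q p̃‖ ≤ (‖χ‖ + ‖v‖) / γ`, and the initial value of `(χ, v)` is `C⁻¹` applied to `(Q p̃, v)`. Hence
the bound has a factor `1 / γ` to spare against both
`κ_x ≥ ‖C⁻¹‖` (`MultiAgent.le_kappaX`) and `κ_u ≥ 8 N γ / (α μ²)` (`MultiAgent.le_kappaU`). As there
are finitely many graphs on `N` nodes, a common bound on their Laplacians depends on `N` only.
-/

/-! ### Absolutely continuous functions -/

namespace AbsolutelyContinuousOnInterval

variable {E F G : Type*} [NormedAddCommGroup E] [NormedSpace ℝ E] [NormedAddCommGroup F]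
  [NormedSpace ℝ F] [NormedAddCommGroup G] [NormedSpace ℝ G] {a b : ℝ}

/-- A bounded bilinear map of two absolutely continuous functions is absolutely continuous. -/
theorem bilin (B : E →L[ℝ] F →L[ℝ] G) {f : ℝ → E} {g : ℝ → F}
    (hf : AbsolutelyContinuousOnInterval f a b) (hg : AbsolutelyContinuousOnInterval g a b) :
    AbsolutelyContinuousOnInterval (fun t => B (f t) (g t)) a b := by
  obtain ⟨C, hC⟩ := hf.exists_bound
  obtain ⟨D, hD⟩ := hg.exists_bound
  unfold AbsolutelyContinuousOnInterval at hf hg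
  apply squeeze_zero' ?_ ?_
    (by simpa using (hg.const_mul (‖B‖ * C)).add (hf.const_mul (‖B‖ * D)))
  · exact Filter.Eventually.of_forall <| fun _ ↦ Finset.sum_nonneg (fun i hi ↦ dist_nonneg)
  rw [eventually_inf_principal]
  filter_upwards with (n, I) hnI
  simp only [Finset.mul_sum, ← Finset.sum_add_distrib]
  gcongr with i hi
  have hI := hnI.left i hi
  have h1 := hC _ hI.1
  have h2 := hD _ hI.2
  refine (dist_triangle _ (B (f (I i).1) (g (I i).2)) _).trans (add_le_add ?_ ?_)
  · rw [dist_eq_norm, dist_eq_norm, ← map_sub]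
    refine (B.le_opNorm₂ _ _).trans ?_
    gcongr
  · rw [dist_eq_norm, dist_eq_norm, ← _root_.sub_apply, ← map_sub]
    refine (B.le_opNorm₂ _ _).trans ?_
    rw [mul_assoc, mul_assoc, mul_comm D]
    gcongr

theorem clm_comp (L : E →L[ℝ] F) {f : ℝ → E} (hf : AbsolutelyContinuousOnInterval f a b) :
    AbsolutelyContinuousOnInterval (fun t => L (f t)) a b := by
  refine squeeze_zero (fun _ => Finset.sum_nonneg fun _ _ => dist_nonneg) (fun I => ?_)
    (by simpa using Tendsto.const_mul ‖L‖ hf)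
  simp only [Finset.mul_sum]
  gcongr with i hi
  rw [dist_eq_norm, dist_eq_norm, ← map_sub]
  exact L.le_opNorm _

/-- The primitive of a Bochner integrable function is absolutely continuous, because its
increments are dominated by those of the primitive of the norm. -/
theorem of_integral {f : ℝ → E} (hf : IntervalIntegrable f volume a b) :
    AbsolutelyContinuousOnInterval (fun t => ∫ s in a..t, f s) a b := by
  have h := hf.norm.absolutelyContinuousOnInterval_intervalIntegral (c := a) left_mem_uIcc
  unfold AbsolutelyContinuousOnInterval at h ⊢
  refine squeeze_zero' (.of_forall fun _ => Finset.sum_nonneg fun _ _ => dist_nonneg) ?_ h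
  rw [eventually_inf_principal]
  filter_upwards with (n, I) hnI
  gcongr with i hi
  have hI := hnI.left i hi
  have hint : ∀ t ∈ uIcc a b, IntervalIntegrable f volume a t := fun t ht =>
    hf.mono_set (uIcc_subset_uIcc left_mem_uIcc ht)
  rw [dist_eq_norm, dist_eq_norm, intervalIntegral.integral_interval_sub_left (hint _ hI.1)
    (hint _ hI.2), intervalIntegral.integral_interval_sub_left (hint _ hI.1).norm
    (hint _ hI.2).norm]
  exact intervalIntegral.norm_integral_le_abs_integral_norm

theorem congr {X : Type*} [PseudoMetricSpace X] {f g : ℝ → X}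
    (hf : AbsolutelyContinuousOnInterval f a b) (h : EqOn f g (uIcc a b)) :
    AbsolutelyContinuousOnInterval g a b := by
  unfold AbsolutelyContinuousOnInterval at hf ⊢
  refine hf.congr' ?_
  rw [eventuallyEq_inf_principal_iff]
  filter_upwards with (n, I) hnI
  refine Finset.sum_congr rfl fun i hi => ?_
  have hI := hnI.left i hi
  simp only [h hI.1, h hI.2]

theorem le_of_ae_deriv_nonpos {φ φ' : ℝ → ℝ} (hab : a ≤ b)
    (hφ : AbsolutelyContinuousOnInterval φ a b)
    (hd : ∀ᵐ t, t ∈ Ioo a b → HasDerivAt φ (φ' t) t ∧ φ' t ≤ 0) : φ b ≤ φ a := by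
  have h := hφ.integral_deriv_eq_sub
  have h0 : ∫ t in a..b, deriv φ t ≤ 0 := by
    rw [intervalIntegral.integral_of_le hab, integral_Ioc_eq_integral_Ioo]
    refine integral_nonpos_of_ae ((ae_restrict_iff' measurableSet_Ioo).2 ?_)
    filter_upwards [hd] with t ht htm
    rw [(ht htm).1.deriv]
    exact (ht htm).2
  linarith

/-- Grönwall's inequality for absolutely continuous functions, with a constant forcing term. -/
theorem le_exp_of_ae_deriv_le {U U' : ℝ → ℝ} {k d : ℝ} (hk : 0 < k) (hd0 : 0 ≤ d) (hab : a ≤ b)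
    (hU : AbsolutelyContinuousOnInterval U a b)
    (hd : ∀ᵐ t, t ∈ Ioo a b → HasDerivAt U (U' t) t ∧ U' t ≤ -k * U t + d) :
    U b ≤ Real.exp (-k * (b - a)) * U a + d / k := by
  have hexp : AbsolutelyContinuousOnInterval (fun t => Real.exp (k * (t - a))) a b :=
    ContDiffOn.absolutelyContinuousOnInterval (by fun_prop)
  have hc : AbsolutelyContinuousOnInterval (fun _ : ℝ => d / k) a b :=
    ContDiffOn.absolutelyContinuousOnInterval contDiffOn_const
  have hφ := hexp.mul (hU.sub hc)
  have key := le_of_ae_deriv_nonpos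
    (φ' := fun t => Real.exp (k * (t - a)) * k * (U t - d / k)
      + Real.exp (k * (t - a)) * U' t) hab hφ (by
    filter_upwards [hd] with t ht htm
    obtain ⟨h1, h2⟩ := ht htm
    refine ⟨?_, ?_⟩
    · have he : HasDerivAt (fun t => Real.exp (k * (t - a))) (Real.exp (k * (t - a)) * k) t := by
        have h := ((hasDerivAt_id t).sub_const a).const_mul k
        simpa using h.exp
      exact he.mul (h1.sub_const (d / k))
    · have : Real.exp (k * (t - a)) * k * (U t - d / k) + Real.exp (k * (t - a)) * U' t
          = Real.exp (k * (t - a)) * (k * U t - d + U' t) := by field_simp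
      rw [this]
      exact mul_nonpos_of_nonneg_of_nonpos (Real.exp_pos _).le (by linarith))
  simp only [Pi.mul_apply, Pi.sub_apply, sub_self, mul_zero, Real.exp_zero, one_mul] at key
  have he : Real.exp (-k * (b - a)) * Real.exp (k * (b - a)) = 1 := by
    rw [← Real.exp_add]; simp
  have h3 := mul_le_mul_of_nonneg_left key (Real.exp_pos (-k * (b - a))).le
  rw [← mul_assoc, he, one_mul] at h3
  have h4 : 0 ≤ Real.exp (-k * (b - a)) * (d / k) := by positivity
  linarith

end AbsolutelyContinuousOnInterval

/-! ### The averaging weight -/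

section Window

variable {V : Type*} [NormedAddCommGroup V] [NormedSpace ℝ V]

/-- The averaging weight `∫_t^{t+T} (t + T - r) M(r) dr`, written as an iterated integral. Its
derivative `∫_t^{t+T} M - T M(t)` trades the current value of `M` for its mean over a window of
length `T`. -/
noncomputable def windowWeight (M : ℝ → V) (T t : ℝ) : V := ∫ s in t..(t + T), ∫ r in t..s, M r

variable {M : ℝ → V} {K T : ℝ}

theorem norm_windowWeight_le (hK : ∀ s, ‖M s‖ ≤ K) (hT : 0 ≤ T) (t : ℝ) :
    ‖windowWeight M T t‖ ≤ K * T * T := by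
  have hK0 : 0 ≤ K := (norm_nonneg _).trans (hK 0)
  have h : ∀ s ∈ uIoc t (t + T), ‖∫ r in t..s, M r‖ ≤ K * T := fun s hs => by
    rw [uIoc_of_le (by linarith)] at hs
    refine (intervalIntegral.norm_integral_le_of_norm_le_const fun r _ => hK r).trans ?_
    rw [abs_of_nonneg (by linarith [hs.1])]
    gcongr
    linarith [hs.2]
  have h2 := intervalIntegral.norm_integral_le_of_norm_le_const h
  rwa [add_sub_cancel_left, abs_of_nonneg hT] at h2

theorem lipschitzWith_integral (hM : ∀ a b, IntervalIntegrable M volume a b)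
    (hK : ∀ s, ‖M s‖ ≤ K) : LipschitzWith K.toNNReal (fun t => ∫ r in (0 : ℝ)..t, M r) := by
  refine LipschitzWith.of_dist_le_mul fun s t => ?_
  rw [dist_eq_norm, intervalIntegral.integral_interval_sub_left (hM _ _) (hM _ _),
    Real.coe_toNNReal _ ((norm_nonneg _).trans (hK 0)), Real.dist_eq]
  exact intervalIntegral.norm_integral_le_of_norm_le_const fun r _ => hK r

theorem windowWeight_eq [CompleteSpace V]
    (hM : ∀ a b, IntervalIntegrable M volume a b) (hK : ∀ s, ‖M s‖ ≤ K) (t : ℝ) :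
    windowWeight M T t = (∫ s in (0 : ℝ)..(t + T), ∫ r in (0 : ℝ)..s, M r)
      - (∫ s in (0 : ℝ)..t, ∫ r in (0 : ℝ)..s, M r) - T • ∫ r in (0 : ℝ)..t, M r := by
  have hc := (lipschitzWith_integral hM hK).continuous
  have h1 : ∀ s, ∫ r in t..s, M r = (∫ r in (0 : ℝ)..s, M r) - ∫ r in (0 : ℝ)..t, M r :=
    fun s => (intervalIntegral.integral_interval_sub_left (hM _ _) (hM _ _)).symm
  simp only [windowWeight, h1]
  rw [intervalIntegral.integral_sub (hc.intervalIntegrable _ _) (by simp),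
    intervalIntegral.integral_interval_sub_left (hc.intervalIntegrable _ _)
    (hc.intervalIntegrable _ _)]
  simp

theorem absolutelyContinuousOnInterval_windowWeight [CompleteSpace V]
    (hM : ∀ a b, IntervalIntegrable M volume a b) (hK : ∀ s, ‖M s‖ ≤ K) (a b : ℝ) :
    AbsolutelyContinuousOnInterval (windowWeight M T) a b := by
  have hL := lipschitzWith_integral hM hK
  have hG : ContDiff ℝ 1 (fun t => ∫ s in (0 : ℝ)..t, ∫ r in (0 : ℝ)..s, M r) := by
    have hd : ∀ t, HasDerivAt (fun t => ∫ s in (0 : ℝ)..t, ∫ r in (0 : ℝ)..s, M r)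
        (∫ r in (0 : ℝ)..t, M r) t := fun t =>
      hL.continuous.integral_hasStrictDerivAt 0 t |>.hasDerivAt
    rw [contDiff_one_iff_deriv]
    exact ⟨fun t => (hd t).differentiableAt, by
      rw [funext fun t => (hd t).deriv]
      exact hL.continuous⟩
  rw [funext (windowWeight_eq (T := T) hM hK)]
  refine AbsolutelyContinuousOnInterval.fun_sub (ContDiffOn.absolutelyContinuousOnInterval ?_)
    (AbsolutelyContinuousOnInterval.const_smul T
      hL.lipschitzOnWith.absolutelyContinuousOnInterval)
  exact ((hG.comp (contDiff_id.add contDiff_const)).sub hG).contDiffOn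

theorem ae_hasDerivAt_windowWeight [CompleteSpace V]
    (hM : ∀ a b, IntervalIntegrable M volume a b) (hK : ∀ s, ‖M s‖ ≤ K) :
    ∀ᵐ t, HasDerivAt (windowWeight M T) ((∫ r in t..(t + T), M r) - T • M t) t := by
  have hL := lipschitzWith_integral hM hK
  have hloc : LocallyIntegrable M volume := by
    rw [locallyIntegrable_iff]
    intro k hk
    obtain ⟨R, hR⟩ := hk.isBounded.subset_closedBall 0
    rw [Real.closedBall_eq_Icc, zero_sub, zero_add] at hR
    exact IntegrableOn.mono_set ((integrableOn_Icc_iff_integrableOn_Ioc (by simp)).2 (hM (-R) R).1)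
      hR
  filter_upwards [LocallyIntegrable.ae_hasDerivAt_integral hloc] with t ht
  rw [funext (windowWeight_eq (T := T) hM hK)]
  have hd : ∀ t, HasDerivAt (fun t => ∫ s in (0 : ℝ)..t, ∫ r in (0 : ℝ)..s, M r)
      (∫ r in (0 : ℝ)..t, M r) t := fun t =>
    hL.continuous.integral_hasStrictDerivAt 0 t |>.hasDerivAt
  have h2 := (HasDerivAt.comp_add_const t T (hd (t + T)))
  rw [← intervalIntegral.integral_interval_sub_left (hM 0 (t + T)) (hM 0 t)]
  exact (h2.sub (hd t)).sub ((ht 0).const_smul T)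

end Window

/-! ### Decay under persistent excitation -/

section Lyapunov

variable {E F : Type*} [NormedAddCommGroup E] [InnerProductSpace ℝ E]
  [NormedAddCommGroup F] [InnerProductSpace ℝ F]

/-- The scalar estimate behind the decay of the Lyapunov function, with `X = ‖χ‖` and `Y = ‖v‖`. The
smallness conditions let `-2εμ X²` and `-2γ Y²` absorb the cross terms by completing squares. -/
theorem lyapunov_derivative_bound {X Y K T ε μ γ b : ℝ} (hX : 0 ≤ X) (hY : 0 ≤ Y) (hK : 0 ≤ K)
    (hε : 0 < ε) (hμ : 0 < μ) (hT : 0 ≤ T) (hb : 0 ≤ b)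
    (h1 : ε * K * T ≤ 1 / 8) (h2 : 16 * (ε * K * T) * K ≤ μ)
    (h3 : ε * K + 13 * ε * K ^ 2 / μ + ε * μ ≤ γ) :
    -2 * ε * μ * X ^ 2 + 2 * X * (ε * K * Y + b)
        + 4 * (ε * K * T) * X * (ε * K * X + ε * K * Y + b)
        + 2 * (-γ * Y ^ 2 + ε * K * X * Y + ε * K * Y ^ 2 + b * Y)
      ≤ -(ε * μ) * (5 / 4 * X ^ 2 + Y ^ 2) + 10 * b ^ 2 / (ε * μ) := by
  have hεμ : 0 < ε * μ := by positivity
  have hδ : 0 ≤ ε * K * T := by positivity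
  set δ := ε * K * T
  have e1 : 4 * δ * X * (ε * K * X + ε * K * Y + b)
      ≤ ε * μ / 4 * X ^ 2 + 1 / 2 * X * (ε * K * Y + b) := by
    have a1 : 4 * δ * K * (ε * X ^ 2) ≤ μ / 4 * (ε * X ^ 2) := by gcongr; linarith
    have a2 : 4 * δ * (X * (ε * K * Y + b)) ≤ 1 / 2 * (X * (ε * K * Y + b)) := by
      gcongr; linarith
    nlinarith
  have e2 : 9 / 2 * ε * K * X * Y ≤ ε * μ / 4 * X ^ 2 + 25 * ε * K ^ 2 / μ * Y ^ 2 := by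
    have a : 0 ≤ ε * (μ / 4) * (X - 10 * K / μ * Y) ^ 2 := by positivity
    have a' : ε * (μ / 4) * (X - 10 * K / μ * Y) ^ 2
        = ε * μ / 4 * X ^ 2 - 5 * (ε * K * X * Y) + 25 * ε * K ^ 2 / μ * Y ^ 2 := by
      field_simp; ring
    have : 0 ≤ ε * K * X * Y := by positivity
    linarith
  have e3 : 5 / 2 * X * b ≤ ε * μ / 4 * X ^ 2 + 9 * b ^ 2 / (ε * μ) := by
    have a : 0 ≤ (ε * μ / 4) * (X - 6 * b / (ε * μ)) ^ 2 := by positivity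
    have a' : (ε * μ / 4) * (X - 6 * b / (ε * μ)) ^ 2
        = ε * μ / 4 * X ^ 2 - 3 * (X * b) + 9 * b ^ 2 / (ε * μ) := by
      field_simp; ring
    have : 0 ≤ X * b := by positivity
    linarith
  have e4 : 2 * b * Y ≤ ε * μ * Y ^ 2 + b ^ 2 / (ε * μ) := by
    have a : 0 ≤ (ε * μ) * (Y - b / (ε * μ)) ^ 2 := by positivity
    have a' : (ε * μ) * (Y - b / (ε * μ)) ^ 2
        = ε * μ * Y ^ 2 - 2 * b * Y + b ^ 2 / (ε * μ) := by
      field_simp; ring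
    linarith
  have e5 : (ε * K + 13 * ε * K ^ 2 / μ + ε * μ) * Y ^ 2 ≤ γ * Y ^ 2 := by gcongr
  have e6 : 10 * b ^ 2 / (ε * μ) = 9 * b ^ 2 / (ε * μ) + b ^ 2 / (ε * μ) := by ring
  have e7 : 0 ≤ ε * K ^ 2 / μ * Y ^ 2 := by positivity
  have e8 : 25 * ε * K ^ 2 / μ * Y ^ 2 = 25 * (ε * K ^ 2 / μ * Y ^ 2) := by ring
  have e9 : (ε * K + 13 * ε * K ^ 2 / μ + ε * μ) * Y ^ 2
    = ε * K * Y ^ 2 + 13 * (ε * K ^ 2 / μ * Y ^ 2) + ε * μ * Y ^ 2 := by ring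
  rw [e6]
  linarith

/-- Exponential decay of a slow variable `χ` driven by a persistently exciting `M`, coupled to a
strongly damped variable `v`, both perturbed by inputs of norm at most `b`. -/
theorem norm_sq_add_norm_sq_le_of_persistently_exciting [CompleteSpace E] {M : ℝ → E →L[ℝ] E}
    {K T ε μ γ b a c : ℝ} {χ χ' : ℝ → E} {v v' : ℝ → F}
    (hM : ∀ a b, IntervalIntegrable M volume a b) (hK : ∀ s, ‖M s‖ ≤ K)
    (hε : 0 < ε) (hμ : 0 < μ) (hT : 0 < T) (hb : 0 ≤ b)
    (hPE : ∀ t, a ≤ t → ∀ y, T * μ * ‖y‖ ^ 2 ≤ inner ℝ y ((∫ s in t..(t + T), M s) y))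
    (h1 : ε * K * T ≤ 1 / 8) (h2 : 16 * (ε * K * T) * K ≤ μ)
    (h3 : ε * K + 13 * ε * K ^ 2 / μ + ε * μ ≤ γ) (hac : a ≤ c)
    (hχ : AbsolutelyContinuousOnInterval χ a c) (hv : AbsolutelyContinuousOnInterval v a c)
    (hd : ∀ᵐ t, t ∈ Ioo a c → HasDerivAt χ (χ' t) t ∧ HasDerivAt v (v' t) t)
    (hχ' : ∀ t ∈ Ioo a c, ‖χ' t + ε • M t (χ t)‖ ≤ ε * K * ‖v t‖ + b)
    (hv' : ∀ t ∈ Ioo a c, inner ℝ (v t) (v' t) ≤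
      -γ * ‖v t‖ ^ 2 + ε * K * ‖χ t‖ * ‖v t‖ + ε * K * ‖v t‖ ^ 2 + b * ‖v t‖) :
    ‖χ c‖ ^ 2 + ‖v c‖ ^ 2 ≤
      2 * Real.exp (-(ε * μ) * (c - a)) * (‖χ a‖ ^ 2 + ‖v a‖ ^ 2) + 20 * (b / (ε * μ)) ^ 2 := by
  have hK0 : 0 ≤ K := (norm_nonneg _).trans (hK 0)
  have hεμ : 0 < ε * μ := by positivity
  set P := windowWeight M T
  have hP := norm_windowWeight_le hK hT.le
  have hPac := absolutelyContinuousOnInterval_windowWeight (T := T) hM hK a c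
  set U : ℝ → ℝ := fun t =>
    inner ℝ (χ t) (χ t) - 2 * ε / T * inner ℝ (χ t) (P t (χ t)) + inner ℝ (v t) (v t) with hU
  have hPχac : AbsolutelyContinuousOnInterval (fun t => P t (χ t)) a c :=
    .bilin (.id ℝ (E →L[ℝ] E)) hPac hχ
  have hUac : AbsolutelyContinuousOnInterval U a c :=
    .fun_add (.fun_sub (.bilin (innerSL ℝ) hχ hχ) (.const_mul _ (.bilin (innerSL ℝ) hχ hPχac)))
      (.bilin (innerSL ℝ) hv hv)
  -- The weight perturbs the square norm by a relative error of at most `1 / 4`.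
  have hcross : ∀ t, |2 * ε / T * inner ℝ (χ t) (P t (χ t))| ≤ 1 / 4 * ‖χ t‖ ^ 2 := fun t => by
    have i1 : |inner ℝ (χ t) (P t (χ t))| ≤ K * T * T * ‖χ t‖ ^ 2 := by
      refine (abs_real_inner_le_norm _ _).trans ?_
      have := (P t).le_of_opNorm_le (hP t) (χ t)
      calc _ ≤ ‖χ t‖ * (K * T * T * ‖χ t‖) := by gcongr
        _ = _ := by ring
    rw [abs_mul, abs_of_nonneg (by positivity)]
    calc _ ≤ 2 * ε / T * (K * T * T * ‖χ t‖ ^ 2) := by gcongr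
      _ = 2 * (ε * K * T) * ‖χ t‖ ^ 2 := by field_simp
      _ ≤ 2 * (1 / 8) * ‖χ t‖ ^ 2 := by gcongr
      _ = _ := by ring
  have hUle : ∀ t, U t ≤ 5 / 4 * ‖χ t‖ ^ 2 + ‖v t‖ ^ 2 := fun t => by
    have := (abs_le.1 (hcross t)).1
    simp only [hU, real_inner_self_eq_norm_sq]
    linarith
  have hUge : ∀ t, 3 / 4 * ‖χ t‖ ^ 2 + ‖v t‖ ^ 2 ≤ U t := fun t => by
    have := (abs_le.1 (hcross t)).2
    simp only [hU, real_inner_self_eq_norm_sq]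
    linarith
  have key := AbsolutelyContinuousOnInterval.le_exp_of_ae_deriv_le (k := ε * μ)
    (d := 10 * b ^ 2 / (ε * μ)) (U' := fun t =>
      (inner ℝ (χ t) (χ' t) + inner ℝ (χ' t) (χ t)) - 2 * ε / T *
        (inner ℝ (χ t) (((∫ r in t..(t + T), M r) - T • M t) (χ t) + P t (χ' t))
          + inner ℝ (χ' t) (P t (χ t)))
      + (inner ℝ (v t) (v' t) + inner ℝ (v' t) (v t))) hεμ (by positivity) hac hUac (by
    filter_upwards [hd, ae_hasDerivAt_windowWeight (T := T) hM hK] with t ht htP htm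
    obtain ⟨d1, d2⟩ := ht htm
    refine ⟨((d1.inner ℝ d1).sub ((d1.inner ℝ (htP.clm_apply d1)).const_mul _)).add
      (d2.inner ℝ d2), ?_⟩
    set w := χ' t + ε • M t (χ t) with hw
    have hwχ : χ' t = w - ε • M t (χ t) := by simp [hw]
    have hwn := hχ' t htm
    have hvn := hv' t htm
    have hpe := hPE t htm.1.le (χ t)
    have hχn : ‖χ' t‖ ≤ ε * K * ‖χ t‖ + ε * K * ‖v t‖ + b := by
      have m1 : ‖ε • M t (χ t)‖ ≤ ε * K * ‖χ t‖ := by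
        rw [norm_smul, Real.norm_of_nonneg hε.le, mul_assoc]
        gcongr
        exact (M t).le_of_opNorm_le (hK t) _
      have := norm_sub_le w (ε • M t (χ t))
      rw [← hwχ] at this
      linarith
    have c1 : |inner ℝ (χ t) (P t (χ' t))| ≤ ‖χ t‖ * (K * T * T * ‖χ' t‖) :=
      (abs_real_inner_le_norm _ _).trans (by gcongr; exact (P t).le_of_opNorm_le (hP t) _)
    have c2 : |inner ℝ (χ' t) (P t (χ t))| ≤ ‖χ' t‖ * (K * T * T * ‖χ t‖) :=
      (abs_real_inner_le_norm _ _).trans (by gcongr; exact (P t).le_of_opNorm_le (hP t) _)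
    have c3 : inner ℝ (χ t) w ≤ ‖χ t‖ * (ε * K * ‖v t‖ + b) :=
      (real_inner_le_norm _ _).trans (by gcongr)
    have hbound := lyapunov_derivative_bound (norm_nonneg (χ t)) (norm_nonneg (v t)) hK0 hε hμ
      hT.le hb h1 h2 h3
    have c4 : 2 * ε / T * (-(inner ℝ (χ t) (P t (χ' t))) - inner ℝ (χ' t) (P t (χ t)))
        ≤ 4 * (ε * K * T) * ‖χ t‖ * (ε * K * ‖χ t‖ + ε * K * ‖v t‖ + b) := by
      calc _ ≤ 2 * ε / T * (‖χ t‖ * (K * T * T * ‖χ' t‖) + ‖χ' t‖ * (K * T * T * ‖χ t‖)) := by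
            gcongr
            have := (abs_le.1 c1).1
            have := (abs_le.1 c2).1
            linarith
        _ = 4 * (ε * K * T) * ‖χ t‖ * ‖χ' t‖ := by field_simp; ring
        _ ≤ _ := by gcongr
    have c5 : 2 * ε * μ * ‖χ t‖ ^ 2
        ≤ 2 * ε / T * inner ℝ (χ t) ((∫ r in t..(t + T), M r) (χ t)) := by
      calc _ = 2 * ε / T * (T * μ * ‖χ t‖ ^ 2) := by field_simp
        _ ≤ _ := by gcongr
    have hU1 := mul_le_mul_of_nonneg_left (hUle t) hεμ.le
    -- The term `⟪χ, M χ⟫` of `d/dt ‖χ‖²` cancels against the one produced by the weight.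
    have e1 : inner ℝ (χ t) (χ' t) = inner ℝ (χ t) w - ε * inner ℝ (χ t) (M t (χ t)) := by
      rw [hwχ, inner_sub_right, inner_smul_right]
    have e2 : 2 * ε / T * inner ℝ (χ t) (((∫ r in t..(t + T), M r) - T • M t) (χ t))
        = 2 * ε / T * inner ℝ (χ t) ((∫ r in t..(t + T), M r) (χ t))
          - 2 * ε * inner ℝ (χ t) (M t (χ t)) := by
      rw [_root_.sub_apply, inner_sub_right, _root_.smul_apply, inner_smul_right]
      field_simp
    rw [real_inner_comm (χ t) (χ' t), real_inner_comm (v t) (v' t), inner_add_right, mul_add,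
      mul_add, e2, e1]
    linarith)
  have hexp := Real.exp_pos (-(ε * μ) * (c - a))
  have hg := hUge c
  have hl := mul_le_mul_of_nonneg_left (hUle a) hexp.le
  have e : (b / (ε * μ)) ^ 2 = b ^ 2 / (ε * μ) / (ε * μ) := by field_simp
  have e' : 10 * b ^ 2 / (ε * μ) / (ε * μ) = 10 * (b ^ 2 / (ε * μ) / (ε * μ)) := by ring
  rw [e]
  rw [e'] at key
  have p1 : 0 ≤ b ^ 2 / (ε * μ) / (ε * μ) := by positivity
  have p2 := mul_nonneg hexp.le (sq_nonneg ‖χ a‖)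
  have p3 := mul_nonneg hexp.le (sq_nonneg ‖v a‖)
  nlinarith [sq_nonneg ‖v c‖]

end Lyapunov

/-! ### Matrices as operators between Euclidean spaces -/

section MatrixOperators

variable {l m n : Type*} [Fintype l] [Fintype m] [Fintype n]

/-- The operator between Euclidean spaces given by a rectangular real matrix. -/
noncomputable def Matrix.l2CLM [DecidableEq n] (A : Matrix m n ℝ) :
    EuclideanSpace ℝ n →L[ℝ] EuclideanSpace ℝ m :=
  (Matrix.toLpLin 2 2 A).toContinuousLinearMap

theorem Matrix.l2CLM_apply [DecidableEq n] (A : Matrix m n ℝ) (x : EuclideanSpace ℝ n) :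
    A.l2CLM x = WithLp.toLp 2 (A *ᵥ x.ofLp) := rfl

theorem Matrix.l2CLM_mul_apply [DecidableEq m] [DecidableEq n] (A : Matrix l m ℝ)
    (B : Matrix m n ℝ) (x : EuclideanSpace ℝ n) :
    (A * B).l2CLM x = A.l2CLM (B.l2CLM x) := by
  simp [Matrix.l2CLM_apply, Matrix.mulVec_mulVec]

theorem Matrix.inner_l2CLM [DecidableEq m] [DecidableEq n] (A : Matrix m n ℝ)
    (x : EuclideanSpace ℝ n) (y : EuclideanSpace ℝ m) :
    inner ℝ (A.l2CLM x) y = inner ℝ x (Aᵀ.l2CLM y) := by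
  simp only [Matrix.l2CLM_apply, EuclideanSpace.inner_eq_star_dotProduct, star_trivial]
  rw [Matrix.mulVec_transpose, Matrix.dotProduct_mulVec]

theorem EuclideanSpace.norm_sq_sum (x : EuclideanSpace ℝ (m ⊕ n)) :
    ‖x‖ ^ 2 = ‖(WithLp.toLp 2 (x.ofLp ∘ Sum.inl) : EuclideanSpace ℝ m)‖ ^ 2
      + ‖(WithLp.toLp 2 (x.ofLp ∘ Sum.inr) : EuclideanSpace ℝ n)‖ ^ 2 := by
  simp [EuclideanSpace.norm_sq_eq, Fintype.sum_sum_type]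

end MatrixOperators

namespace MultiAgent

/-! ### Switched trajectories -/

/-- Functions selected by the switching signal inherit integrability from the single modes: on each
of the finitely many pieces only one mode is active. -/
theorem FiniteSwitching.intervalIntegrable {E : Type*} [NormedAddCommGroup E] {q : ℕ}
    {σ : ℝ → Fin q} (hσ : FiniteSwitching σ) {h : Fin q → ℝ → E} {a b : ℝ} (ha : 0 ≤ a)
    (hab : a ≤ b) (hh : ∀ c, IntervalIntegrable (h c) volume a b) :
    IntervalIntegrable (fun s => h (σ s) s) volume a b := by
  rcases hab.eq_or_lt with rfl | hlt
  · simp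
  obtain ⟨m, τ, h0, hm, hτ⟩ := hσ a (b - a) ha (by linarith)
  rw [add_sub_cancel] at hm
  have hmono : ∀ j k, j ≤ k → k ≤ m + 1 → τ j ≤ τ k := fun j k hjk => by
    induction k, hjk using Nat.le_induction with
    | base => exact fun _ => le_rfl
    | succ k hk ih => exact fun hk' => (ih (by omega)).trans (hτ k (by omega)).1.le
  have key : IntervalIntegrable (fun s => h (σ s) s) volume (τ 0) (τ (m + 1)) := by
    refine IntervalIntegrable.trans_iterate fun k hk => ?_
    obtain ⟨hlt, hc⟩ := hτ k (by omega)
    have hsub : uIcc (τ k) (τ (k + 1)) ⊆ uIcc a b := by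
      rw [uIcc_of_le hlt.le, uIcc_of_le hab, ← h0, ← hm]
      exact Icc_subset_Icc (hmono 0 k (by omega) (by omega))
        (hmono (k + 1) (m + 1) (by omega) le_rfl)
    have hi := (hh (σ (τ k))).mono_set hsub
    rw [intervalIntegrable_iff_integrableOn_Ioo_of_le hlt.le] at hi ⊢
    exact hi.congr_fun (fun s hs => by rw [hc s ⟨hs.1.le, hs.2⟩]) measurableSet_Ioo
  rwa [h0, hm] at key

theorem MemLpe.intervalIntegrable {E : Type*} [NormedAddCommGroup E] {p : ℝ≥0∞} {u : ℝ → E}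
    (hp : 1 ≤ p) (hu : MemLpe p u) {a b : ℝ} (ha : 0 ≤ a) (hab : a ≤ b) :
    IntervalIntegrable u volume a b := by
  rw [intervalIntegrable_iff_integrableOn_Icc_of_le hab]
  exact IntegrableOn.mono_set ((hu b (ha.trans hab)).integrable hp) (Icc_subset_Icc_left ha)

variable {N q : ℕ} {α γ t₀ : ℝ} {G : Fin q → SimpleGraph (Fin N)} {σ : ℝ → Fin q}
  {𝒜 : Finset (Fin N)} {u : ℝ → EuclideanSpace ℝ 𝒜} {x : ℝ → EuclideanSpace ℝ (Fin N ⊕ Fin N)}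
  {p : ℝ≥0∞}

theorem IsTrajectory.intervalIntegrable (hx : IsTrajectory α γ G σ 𝒜 u t₀ x)
    (hσ : FiniteSwitching σ) (hp : 1 ≤ p) (hu : MemLpe p u) (ht₀ : 0 ≤ t₀) {c : ℝ} (hc : t₀ ≤ c) :
    IntervalIntegrable (fun s => WithLp.toLp 2
      (sysA α γ (G (σ s)) *ᵥ (x s).ofLp + sysB 𝒜 *ᵥ (u s).ofLp)) volume t₀ c := by
  refine hσ.intervalIntegrable (h := fun c s => WithLp.toLp 2
    (sysA α γ (G c) *ᵥ (x s).ofLp + sysB 𝒜 *ᵥ (u s).ofLp)) ht₀ hc fun k => ?_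
  have h1 : IntervalIntegrable (fun s => (sysA α γ (G k)).l2CLM (x s)) volume t₀ c :=
    ContinuousOn.intervalIntegrable
      ((ContinuousLinearMap.continuous _).comp_continuousOn
        (hx.1.mono (by rw [uIcc_of_le hc]; exact Icc_subset_Ici_self)))
  have hu' := hu.intervalIntegrable hp ht₀ hc
  have h2 : IntervalIntegrable (fun s => (sysB 𝒜).l2CLM (u s)) volume t₀ c :=
    ⟨(sysB 𝒜).l2CLM.integrable_comp hu'.1, (sysB 𝒜).l2CLM.integrable_comp hu'.2⟩
  exact h1.add h2

theorem IsTrajectory.absolutelyContinuousOnInterval (hx : IsTrajectory α γ G σ 𝒜 u t₀ x)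
    (hσ : FiniteSwitching σ) (hp : 1 ≤ p) (hu : MemLpe p u) (ht₀ : 0 ≤ t₀) {c : ℝ} (hc : t₀ ≤ c) :
    AbsolutelyContinuousOnInterval x t₀ c := by
  have h := AbsolutelyContinuousOnInterval.of_integral (hx.intervalIntegrable hσ hp hu ht₀ hc)
  have hconst : AbsolutelyContinuousOnInterval (fun _ : ℝ => x t₀) t₀ c :=
    ContDiffOn.absolutelyContinuousOnInterval contDiffOn_const
  refine (hconst.fun_add h).congr fun t ht => ?_
  rw [uIcc_of_le hc] at ht
  exact (hx.2 t ht.1).symm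

theorem IsTrajectory.ae_hasDerivAt (hx : IsTrajectory α γ G σ 𝒜 u t₀ x)
    (hσ : FiniteSwitching σ) (hp : 1 ≤ p) (hu : MemLpe p u) (ht₀ : 0 ≤ t₀) {c : ℝ} (hc : t₀ ≤ c) :
    ∀ᵐ t, t ∈ Ioo t₀ c → HasDerivAt x (WithLp.toLp 2
      (sysA α γ (G (σ t)) *ᵥ (x t).ofLp + sysB 𝒜 *ᵥ (u t).ofLp)) t := by
  filter_upwards [(hx.intervalIntegrable hσ hp hu ht₀ hc).ae_hasDerivAt_integral] with t ht htm
  have h := ht (by rw [uIcc_of_le hc]; exact Ioo_subset_Icc_self htm) t₀ left_mem_uIcc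
  refine (h.const_add (x t₀)).congr_of_eventuallyEq ?_
  filter_upwards [Ioi_mem_nhds htm.1] with s hs
  exact hx.2 s hs.le

/-- The relative positions `p̃` of a state `x = col (p̃, v)`. -/
noncomputable def pos : EuclideanSpace ℝ (Fin N ⊕ Fin N) →L[ℝ] EuclideanSpace ℝ (Fin N) :=
  (Matrix.fromCols 1 0 : Matrix (Fin N) (Fin N ⊕ Fin N) ℝ).l2CLM

/-- The velocities `v` of a state `x = col (p̃, v)`. -/
noncomputable def vel : EuclideanSpace ℝ (Fin N ⊕ Fin N) →L[ℝ] EuclideanSpace ℝ (Fin N) :=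
  (Matrix.fromCols 0 1 : Matrix (Fin N) (Fin N ⊕ Fin N) ℝ).l2CLM

theorem pos_apply (y : EuclideanSpace ℝ (Fin N ⊕ Fin N)) :
    pos y = WithLp.toLp 2 (y.ofLp ∘ Sum.inl) := by
  simp [pos, l2CLM_apply, fromCols_mulVec]

theorem vel_apply (y : EuclideanSpace ℝ (Fin N ⊕ Fin N)) :
    vel y = WithLp.toLp 2 (y.ofLp ∘ Sum.inr) := by
  simp [vel, l2CLM_apply, fromCols_mulVec]

theorem norm_sq_eq_pos_vel (y : EuclideanSpace ℝ (Fin N ⊕ Fin N)) :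
    ‖y‖ ^ 2 = ‖pos y‖ ^ 2 + ‖vel y‖ ^ 2 := by
  rw [EuclideanSpace.norm_sq_sum, pos_apply, vel_apply]

/-- The operator `I_𝒜` distributing the attack signal over the malicious agents. -/
noncomputable def attack (𝒜 : Finset (Fin N)) : EuclideanSpace ℝ 𝒜 →L[ℝ] EuclideanSpace ℝ (Fin N) :=
  ((1 : Matrix (Fin N) (Fin N) ℝ).submatrix id Subtype.val).l2CLM

theorem norm_attack (w : EuclideanSpace ℝ 𝒜) : ‖attack 𝒜 w‖ = ‖w‖ := by
  have h : ((1 : Matrix (Fin N) (Fin N) ℝ).submatrix id (Subtype.val : 𝒜 → Fin N))ᵀ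
      * ((1 : Matrix (Fin N) (Fin N) ℝ).submatrix id (Subtype.val : 𝒜 → Fin N)) = 1 := by
    rw [transpose_submatrix, transpose_one, ← submatrix_mul _ _ _ _ _ Function.bijective_id,
      one_mul]
    exact submatrix_one _ Subtype.val_injective
  rw [← sq_eq_sq₀ (norm_nonneg _) (norm_nonneg _), ← real_inner_self_eq_norm_sq, attack,
    Matrix.inner_l2CLM, ← Matrix.l2CLM_mul_apply, h, Matrix.l2CLM_apply, one_mulVec,
    real_inner_self_eq_norm_sq]

theorem pos_vectorField (H : SimpleGraph (Fin N)) (y : EuclideanSpace ℝ (Fin N ⊕ Fin N))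
    (w : EuclideanSpace ℝ 𝒜) :
    pos (WithLp.toLp 2 (sysA α γ H *ᵥ y.ofLp + sysB 𝒜 *ᵥ w.ofLp)) = vel y := by
  rw [pos_apply, vel_apply]
  simp [sysA, sysB, fromBlocks_mulVec, fromRows_mulVec]
  ext i
  simp

theorem vel_vectorField (H : SimpleGraph (Fin N)) (y : EuclideanSpace ℝ (Fin N ⊕ Fin N))
    (w : EuclideanSpace ℝ 𝒜) :
    vel (WithLp.toLp 2 (sysA α γ H *ᵥ y.ofLp + sysB 𝒜 *ᵥ w.ofLp))
      = -(α • (lap H).l2CLM (pos y)) - γ • vel y + attack 𝒜 w := by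
  rw [vel_apply, pos_apply, vel_apply, attack, l2CLM_apply, l2CLM_apply]
  simp [sysA, sysB, fromBlocks_mulVec, fromRows_mulVec]
  ext i
  simp [neg_mulVec, smul_mulVec, sub_eq_add_neg]

/-! ### The Laplacian and the reduction matrix -/

open Classical in
theorem lap_apply_of_ne (H : SimpleGraph (Fin N)) {a b : Fin N} (h : a ≠ b) :
    lap H a b = if H.Adj a b then -1 else 0 := by
  simp only [lap, SimpleGraph.lapMatrix, SimpleGraph.degMatrix, Matrix.sub_apply,
    diagonal_apply_ne _ h, SimpleGraph.adjMatrix_apply]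
  split_ifs <;> simp

/-- There are finitely many graphs on `N` nodes, so their Laplacians have a common norm bound. -/
theorem exists_norm_lap_le (N : ℕ) :
    ∃ K : ℝ, 0 ≤ K ∧ ∀ H : SimpleGraph (Fin N), ‖(lap H).l2CLM‖ ≤ K := by
  obtain ⟨K, hK⟩ := (Set.finite_range fun H : SimpleGraph (Fin N) => ‖(lap H).l2CLM‖).bddAbove
  exact ⟨K, (norm_nonneg _).trans (hK ⟨⊥, rfl⟩), fun H => hK ⟨H, rfl⟩⟩

theorem IsReduction.norm_transpose {Q : Matrix (Fin (N - 1)) (Fin N) ℝ} (hQ : IsReduction Q)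
    (y : EuclideanSpace ℝ (Fin (N - 1))) : ‖Qᵀ.l2CLM y‖ = ‖y‖ := by
  rw [← sq_eq_sq₀ (norm_nonneg _) (norm_nonneg _), ← real_inner_self_eq_norm_sq,
    Matrix.inner_l2CLM, transpose_transpose, ← Matrix.l2CLM_mul_apply, hQ.2.1,
    Matrix.l2CLM_apply, one_mulVec, real_inner_self_eq_norm_sq]

theorem IsReduction.norm_le {Q : Matrix (Fin (N - 1)) (Fin N) ℝ} (hQ : IsReduction Q)
    (y : EuclideanSpace ℝ (Fin N)) : ‖Q.l2CLM y‖ ≤ ‖y‖ := by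
  have h : ‖Q.l2CLM y‖ ^ 2 ≤ ‖y‖ * ‖Q.l2CLM y‖ := by
    rw [← real_inner_self_eq_norm_sq, Matrix.inner_l2CLM]
    exact (real_inner_le_norm _ _).trans_eq (by rw [hQ.norm_transpose])
  by_contra! hlt
  nlinarith [norm_nonneg y]

theorem lap_mulVec_const (H : SimpleGraph (Fin N)) (c : ℝ) : lap H *ᵥ (fun _ => c) = 0 := by
  classical
  have h := SimpleGraph.lapMatrix_mulVec_const_eq_zero (R := ℝ) H
  have hc : (fun _ : Fin N => c) = c • fun _ => (1 : ℝ) := by ext; simp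
  rw [hc, mulVec_smul, lap]
  convert! smul_zero c

theorem IsReduction.lap_apply {Q : Matrix (Fin (N - 1)) (Fin N) ℝ} (hQ : IsReduction Q)
    (H : SimpleGraph (Fin N)) (y : EuclideanSpace ℝ (Fin N)) :
    (lap H).l2CLM (Qᵀ.l2CLM (Q.l2CLM y)) = (lap H).l2CLM y := by
  rw [← Matrix.l2CLM_mul_apply Qᵀ, hQ.2.2]
  have : (1 - (1 / (N : ℝ)) • Matrix.of (fun _ _ => (1 : ℝ)) : Matrix (Fin N) (Fin N) ℝ).l2CLM y
      = y - WithLp.toLp 2 (fun _ => 1 / (N : ℝ) * ∑ j, y j) := by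
    rw [Matrix.l2CLM_apply, sub_mulVec, one_mulVec, smul_mulVec]
    ext i
    simp [mulVec, dotProduct]
  rw [this, map_sub, sub_eq_self, Matrix.l2CLM_apply, lap_mulVec_const, WithLp.toLp_zero]

theorem matC_inv {γ : ℝ} (hγ : γ ≠ 0) (Q : Matrix (Fin (N - 1)) (Fin N) ℝ) :
    (matC γ Q)⁻¹ = Matrix.fromBlocks (γ • 1) Q 0 1 := by
  refine Matrix.inv_eq_right_inv ?_
  rw [matC, fromBlocks_multiply]
  simp [smul_smul, hγ]

theorem one_le_opNorm_matC (hN : 0 < N) (γ : ℝ) (Q : Matrix (Fin (N - 1)) (Fin N) ℝ) :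
    1 ≤ opNorm (matC γ Q) := by
  set e : EuclideanSpace ℝ (Fin N) := EuclideanSpace.single ⟨0, hN⟩ 1
  have he : ‖e‖ = 1 := by simp [e]
  set w : EuclideanSpace ℝ (Fin (N - 1) ⊕ Fin N) := WithLp.toLp 2 (Sum.elim 0 e.ofLp)
  have hw : ‖w‖ = 1 := by
    rw [← sq_eq_sq₀ (norm_nonneg _) zero_le_one, EuclideanSpace.norm_sq_sum]
    simp [w, Sum.elim_comp_inl, Sum.elim_comp_inr, he]
  have h := (Matrix.toEuclideanCLM (n := Fin (N - 1) ⊕ Fin N) (𝕜 := ℝ) (matC γ Q)).le_opNorm w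
  rw [hw, mul_one] at h
  refine le_trans ?_ h
  rw [← sq_le_sq₀ zero_le_one (norm_nonneg _), EuclideanSpace.norm_sq_sum,
    ofLp_toEuclideanCLM, matC, fromBlocks_mulVec]
  simp [w, Sum.elim_comp_inl, Sum.elim_comp_inr, he]

/-- The inverse of `C` maps `col (Q p̃, v)` to `col (γ Q p̃ + Q v, v)`. -/
theorem norm_sq_add_le_opNorm_inv {γ : ℝ} (hγ : γ ≠ 0) {Q : Matrix (Fin (N - 1)) (Fin N) ℝ}
    (hQ : IsReduction Q) (y : EuclideanSpace ℝ (Fin N ⊕ Fin N)) :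
    ‖γ • Q.l2CLM (pos y) + Q.l2CLM (vel y)‖ ^ 2 + ‖vel y‖ ^ 2
      ≤ (opNorm ((matC γ Q)⁻¹) * ‖y‖) ^ 2 := by
  set w : EuclideanSpace ℝ (Fin (N - 1) ⊕ Fin N) :=
    WithLp.toLp 2 (Sum.elim (Q.l2CLM (pos y)).ofLp (vel y).ofLp)
  have hw : ‖w‖ ≤ ‖y‖ := by
    rw [← sq_le_sq₀ (norm_nonneg _) (norm_nonneg _), EuclideanSpace.norm_sq_sum,
      norm_sq_eq_pos_vel]
    simp only [w, Sum.elim_comp_inl, Sum.elim_comp_inr, WithLp.toLp_ofLp]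
    gcongr
    exact hQ.norm_le _
  have h := (Matrix.toEuclideanCLM (n := Fin (N - 1) ⊕ Fin N) (𝕜 := ℝ) (matC γ Q)⁻¹).le_opNorm w
  have h2 := pow_le_pow_left₀ (norm_nonneg _)
    (h.trans (mul_le_mul_of_nonneg_left hw (norm_nonneg _))) 2
  refine le_trans (le_of_eq ?_) h2
  rw [EuclideanSpace.norm_sq_sum, ofLp_toEuclideanCLM, matC_inv hγ, fromBlocks_mulVec]
  simp only [w, Sum.elim_comp_inl, Sum.elim_comp_inr]
  congr 2
  · simp [Matrix.l2CLM_apply, smul_mulVec]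
  · simp

/-- Persistent excitation in the form used by the Lyapunov argument: the entrywise integral of the
Loewner inequality is the Bochner integral of the operators. -/
theorem PEConnected.le_inner {q : ℕ} {G : Fin q → SimpleGraph (Fin N)} {σ : ℝ → Fin q}
    {Q : Matrix (Fin (N - 1)) (Fin N) ℝ} {μ T : ℝ} (h : PEConnected G σ Q μ T)
    (hσ : FiniteSwitching σ) (hT : 0 < T) {t : ℝ} (ht : 0 ≤ t)
    (y : EuclideanSpace ℝ (Fin (N - 1))) :
    T * μ * ‖y‖ ^ 2 ≤ inner ℝ y ((∫ s in t..(t + T), (Q * lap (G (σ s)) * Qᵀ).l2CLM) y) := by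
  have hint : ∀ {E : Type} [NormedAddCommGroup E] (f : Fin q → E),
      IntervalIntegrable (fun s => f (σ s)) volume t (t + T) := fun f =>
    hσ.intervalIntegrable (h := fun c _ => f c) ht (by linarith) fun _ => by simp
  have h0 := (h t ht).dotProduct_mulVec_nonneg y.ofLp
  have e1 : inner ℝ y ((∫ s in t..(t + T), (Q * lap (G (σ s)) * Qᵀ).l2CLM) y)
      = ∫ s in t..(t + T), ∑ a, ∑ b, y a * y b * (Q * lap (G (σ s)) * Qᵀ) a b := by
    rw [ContinuousLinearMap.intervalIntegral_apply (hint fun c => (Q * lap (G c) * Qᵀ).l2CLM),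
      ← innerSL_apply_apply ℝ, ← ContinuousLinearMap.intervalIntegral_comp_comm _
      (hint fun c => (Q * lap (G c) * Qᵀ).l2CLM y)]
    refine intervalIntegral.integral_congr fun s _ => ?_
    simp only [innerSL_apply_apply, Matrix.l2CLM_apply, PiLp.inner_apply, mulVec, dotProduct,
      RCLike.inner_apply, conj_trivial, Finset.sum_mul]
    refine Finset.sum_congr rfl fun a _ => Finset.sum_congr rfl fun b _ => by ring
  have e2 : ∑ a, ∑ b, y a * y b * ∫ s in t..(t + T), (Q * lap (G (σ s)) * Qᵀ) a b
      = ∫ s in t..(t + T), ∑ a, ∑ b, y a * y b * (Q * lap (G (σ s)) * Qᵀ) a b := by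
    rw [intervalIntegral.integral_finsetSum fun a _ =>
      hint fun c => ∑ b, y a * y b * (Q * lap (G c) * Qᵀ) a b]
    refine Finset.sum_congr rfl fun a _ => ?_
    rw [intervalIntegral.integral_finsetSum fun b _ =>
      hint fun c => y a * y b * (Q * lap (G c) * Qᵀ) a b]
    refine Finset.sum_congr rfl fun b _ => ?_
    rw [intervalIntegral.integral_const_mul]
  rw [e1, ← e2]
  rw [sub_mulVec, dotProduct_sub, smul_mulVec, one_mulVec, dotProduct_smul] at h0
  have e3 : star y.ofLp ⬝ᵥ y.ofLp = ‖y‖ ^ 2 := by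
    rw [EuclideanSpace.norm_sq_eq]
    simp [dotProduct, sq]
  have e4 : star y.ofLp ⬝ᵥ (Matrix.of (fun a b => (1 / T) *
      ∫ τ in t..(t + T), (Q * lap (G (σ τ)) * Qᵀ) a b) *ᵥ y.ofLp)
      = 1 / T * ∑ a, ∑ b, y a * y b * ∫ s in t..(t + T), (Q * lap (G (σ s)) * Qᵀ) a b := by
    simp only [dotProduct, mulVec, star_trivial, of_apply, Finset.mul_sum]
    refine Finset.sum_congr rfl fun a _ => Finset.sum_congr rfl fun b _ => by ring
  rw [e3, e4, smul_eq_mul] at h0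
  have h1 := mul_le_mul_of_nonneg_left (sub_nonneg.1 h0) hT.le
  rw [← mul_assoc, ← mul_assoc, mul_one_div_cancel hT.ne', one_mul] at h1
  exact h1

/-! ### The coupling term -/

/-- On `S2 G i` the coupling term is `-α` times the Laplacian of `outerGraph G i` applied to the
positions: that Laplacian has no entries between `S2 G i` and `V1 G i`, and its entries between
`S2 G i` and `R G i` are those of the Laplacian of `G`. -/
theorem norm_rho_le {α : ℝ} (hα : 0 ≤ α) (G : SimpleGraph (Fin N)) (i : Fin N)
    (y : EuclideanSpace ℝ (Fin N ⊕ Fin N)) :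
    ‖rho α G i (stateI G i y) (stateR G i y)‖
      ≤ α * ‖(lap (outerGraph G i)).l2CLM (pos y)‖ := by
  classical
  set w := (lap (outerGraph G i)).l2CLM (pos y) with hw
  have hV : ∀ j : Fin N, j ∉ V2 G i ↔ j ∈ R G i := fun j => by simp [R]
  have hS : ∀ s : S2 G i, (lapOuter G i *ᵥ fun j => y.ofLp (Sum.inl j.1)) s
      + (lap23 G i *ᵥ fun j => y.ofLp (Sum.inl j.1)) s = w s.1 := fun s => by
    have hs := s.2
    have hterm : ∀ j, lap (outerGraph G i) s.1 j * y.ofLp (Sum.inl j)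
        = (if j ∈ S2 G i then lap (outerGraph G i) s.1 j * y.ofLp (Sum.inl j) else 0)
          + (if j ∈ R G i then lap G s.1 j * y.ofLp (Sum.inl j) else 0) := fun j => by
      by_cases hj : j ∈ S2 G i
      · have : j ∉ R G i := by
          rw [← hV, not_not]; exact (Finset.mem_sdiff.1 hj).1
        simp [hj, this]
      · have hne : s.1 ≠ j := fun h => hj (h ▸ hs)
        by_cases hjR : j ∈ R G i
        · simp only [hj, hjR, if_true, if_false, zero_add]
          congr 1
          rw [lap_apply_of_ne _ hne, lap_apply_of_ne _ hne]
          simp [outerGraph, hs, hjR]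
        · have h0 : lap (outerGraph G i) s.1 j = 0 := by
            rw [lap_apply_of_ne _ hne]
            simp [outerGraph, hj, hjR]
          simp [hj, hjR, h0]
    rw [hw, Matrix.l2CLM_apply, pos_apply]
    simp only [mulVec, dotProduct, Function.comp_apply]
    rw [Finset.sum_congr rfl fun j _ => hterm j, Finset.sum_add_distrib, ← Finset.sum_filter,
      ← Finset.sum_filter]
    rw [Finset.filter_mem_eq_inter, Finset.univ_inter, Finset.filter_mem_eq_inter,
      Finset.univ_inter, ← Finset.sum_coe_sort (S2 G i), ← Finset.sum_coe_sort (R G i)]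
    rfl
  have hρ : ‖rho α G i (stateI G i y) (stateR G i y)‖ ^ 2 = ∑ s : S2 G i, (α * w s.1) ^ 2 := by
    rw [EuclideanSpace.norm_sq_eq, Fintype.sum_sum_type]
    have h1 : ∀ k, (rho α G i (stateI G i y) (stateR G i y)).ofLp (Sum.inl k) = 0 := fun k => by
      simp [rho, outerA, couplingA, fromBlocks_mulVec]
    have h2 : ∀ k, (rho α G i (stateI G i y) (stateR G i y)).ofLp (Sum.inr (Sum.inl k)) = 0 :=
      fun k => by
        simp [rho, outerA, couplingA, fromBlocks_mulVec, fromRows_mulVec]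
    have h3 : ∀ s, (rho α G i (stateI G i y) (stateR G i y)).ofLp (Sum.inr (Sum.inr s))
        = -(α * w s.1) := fun s => by
      rw [← hS, mul_add, neg_add]
      simp [rho, outerA, couplingA, fromBlocks_mulVec, fromRows_mulVec, neg_mulVec, smul_mulVec]
      rfl
    simp only [Fintype.sum_sum_type, h1, h2, h3, Real.norm_eq_abs, sq_abs]
    simp
  rw [← sq_le_sq₀ (norm_nonneg _) (by positivity), hρ, mul_pow, EuclideanSpace.norm_sq_eq,
    Finset.mul_sum]
  rw [Finset.sum_coe_sort (S2 G i) fun s => (α * w s) ^ 2]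
  refine (Finset.sum_le_univ_sum_of_nonneg fun s => by positivity).trans (le_of_eq ?_)
  refine Finset.sum_congr rfl fun s _ => ?_
  rw [mul_pow, Real.norm_eq_abs, sq_abs]

/-! ### The constants -/

/-- With `y` the fraction inside the logarithm, `λ_χ = -(1 - y) ln (1 - y) / (2T) ≤ y / (2T)`,
because `ln (1 - y) ≥ 1 - 1 / (1 - y)`. -/
theorem lamChi_le {N : ℕ} {α γ μ T : ℝ} (hα : 0 < α) (hγ : 0 < γ) (hμ : 0 < μ) (hμN : μ ≤ N)
    (hT : 0 < T) : lamChi N α γ μ T ≤ α / γ * μ / 2 := by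
  have hε : 0 < α / γ := by positivity
  set ε := α / γ with hεdef
  set y := ε * μ * T / (1 + ε ^ 2 * (N : ℝ) ^ 2 * T ^ 2) with hy
  have hy0 : 0 ≤ y := by positivity
  have hyε : y ≤ ε * μ * T := div_le_self (by positivity) (by nlinarith [sq_nonneg (ε * N * T)])
  have hy1 : y < 1 := by
    rw [hy, div_lt_one (by positivity)]
    have : ε * μ * T ≤ ε * N * T := by gcongr
    nlinarith [sq_nonneg (ε * N * T - 1)]
  have he : lamChi N α γ μ T = -Real.log (1 - y) * (1 - y) / (2 * T) := by
    have h1 : eta N α γ μ T = -(1 / (2 * T)) * Real.log (1 - y) := rfl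
    have h2 : -2 * eta N α γ μ T * T = Real.log (1 - y) := by rw [h1]; field_simp
    rw [lamChi, h2, Real.exp_log (by linarith), h1]
    ring
  have hlog := Real.one_sub_inv_le_log_of_pos (show 0 < 1 - y by linarith)
  have h3 : -Real.log (1 - y) * (1 - y) ≤ y := by
    have := mul_le_mul_of_nonneg_right hlog (show 0 ≤ 1 - y by linarith)
    rw [sub_mul, inv_mul_cancel₀ (by linarith)] at this
    linarith
  rw [he, div_le_iff₀ (by positivity)]
  nlinarith

theorem le_kappaX {N : ℕ} {α γ μ T β : ℝ} (hN : 0 < N) (hα : 0 < α) (hγ : 0 < γ)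
    (hβ : 0 < β)
    (Q : Matrix (Fin (N - 1)) (Fin N) ℝ) :
    opNorm ((matC γ Q)⁻¹) ≤ kappaX α γ μ T β Q := by
  have hN' : (0 : ℝ) < N := by exact_mod_cast hN
  have h1 : min (γ / (α * N)) β ≤ max (lamChi N α γ μ T)⁻¹ β :=
    (min_le_right _ _).trans (le_max_right _ _)
  have h2 : 1 ≤ Real.sqrt (max (lamChi N α γ μ T)⁻¹ β / min (γ / (α * N)) β) :=
    Real.one_le_sqrt.2 ((one_le_div (lt_min (by positivity) hβ)).2 h1)
  have h3 := one_le_opNorm_matC hN γ Q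
  have h4 : 0 ≤ opNorm ((matC γ Q)⁻¹) := norm_nonneg _
  exact le_mul_of_one_le_left h4 (one_le_mul_of_one_le_of_one_le h3 h2)

/-- The value on the left comes from `λ_χ⁻¹ / (λ_x γ / (2αN))` with both rates at most
`(α/γ) μ / 2`. -/
theorem le_kappaU {N : ℕ} {α γ μ T β lamX : ℝ} (hN : 0 < N) (hα : 0 < α) (hγ : 0 < γ)
    (hμ : 0 < μ) (hμN : μ ≤ N) (hT : 0 < T) (hβ : 0 < β) (hlam0 : 0 < lamX)
    (hlam : lamX < lamChi N α γ μ T) (Q : Matrix (Fin (N - 1)) (Fin N) ℝ) :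
    8 * N * γ / (α * μ ^ 2) ≤ kappaU α γ μ T β lamX Q := by
  have hN' : (0 : ℝ) < N := by exact_mod_cast hN
  have hl := lamChi_le hα hγ hμ hμN hT
  have hlχ := hlam0.trans hlam
  have h1 : 8 * N * γ / (α * μ ^ 2) = (α / γ * μ / 2)⁻¹ / (α / γ * μ / 2 * (γ / (2 * α * N))) := by
    field_simp; norm_num
  have hmin : 0 < min (γ / (2 * α * N)) (β / 2) := lt_min (by positivity) (by positivity)
  have h2 : (α / γ * μ / 2)⁻¹ / (α / γ * μ / 2 * (γ / (2 * α * N)))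
      ≤ max (lamChi N α γ μ T)⁻¹ β / (lamX * min (γ / (2 * α * N)) (β / 2)) := by
    gcongr
    · exact (inv_anti₀ hlχ hl).trans (le_max_left _ _)
    · linarith
    · exact min_le_left _ _
  rw [h1]
  refine h2.trans (le_mul_of_one_le_left ?_ (one_le_opNorm_matC hN γ Q))
  exact div_nonneg (hβ.le.trans (le_max_right _ _)) (by positivity)

/-! ### Decay along trajectories -/

/-- The persistently excited coordinates `χ = γ Q p̃ + Q v` together with `v` decay
exponentially, up to a multiple of the attack. -/
theorem IsTrajectory.norm_sq_le {N q : ℕ} {α γ μ T K b t₀ c : ℝ} {G : Fin q → SimpleGraph (Fin N)}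
    {σ : ℝ → Fin q} {Q : Matrix (Fin (N - 1)) (Fin N) ℝ} {𝒜 : Finset (Fin N)}
    {u : ℝ → EuclideanSpace ℝ 𝒜} {x : ℝ → EuclideanSpace ℝ (Fin N ⊕ Fin N)} {p : ℝ≥0∞}
    (hx : IsTrajectory α γ G σ 𝒜 u t₀ x) (hα : 0 < α) (hγ : 0 < γ) (hμ : 0 < μ) (hT : 0 < T)
    (hK0 : 0 ≤ K) (hK : ∀ H : SimpleGraph (Fin N), ‖(lap H).l2CLM‖ ≤ K) (hQ : IsReduction Q)
    (hσ : FiniteSwitching σ) (hPE : PEConnected G σ Q μ T) (hp : 1 ≤ p) (hu : MemLpe p u)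
    (h1 : α / γ * K * T ≤ 1 / 8) (h2 : 16 * (α / γ * K * T) * K ≤ μ)
    (h3 : α / γ * K + 13 * (α / γ) * K ^ 2 / μ + α / γ * μ ≤ γ) (ht₀ : 0 ≤ t₀) (hc : t₀ ≤ c)
    (hb0 : 0 ≤ b) (hb : ∀ s ∈ Ioo t₀ c, ‖u s‖ ≤ b) :
    ‖γ • Q.l2CLM (pos (x c)) + Q.l2CLM (vel (x c))‖ ^ 2 + ‖vel (x c)‖ ^ 2 ≤
      2 * Real.exp (-(α / γ * μ) * (c - t₀)) *
        (‖γ • Q.l2CLM (pos (x t₀)) + Q.l2CLM (vel (x t₀))‖ ^ 2 + ‖vel (x t₀)‖ ^ 2)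
      + 20 * (b / (α / γ * μ)) ^ 2 := by
  have hKa : ∀ (H : SimpleGraph (Fin N)) y, ‖(lap H).l2CLM y‖ ≤ K * ‖y‖ := fun H y =>
    (lap H).l2CLM.le_of_opNorm_le (hK H) y
  -- The signal is only constrained on `[0, ∞)`, so `M` is cut off at negative times.
  set M : ℝ → EuclideanSpace ℝ (Fin (N - 1)) →L[ℝ] EuclideanSpace ℝ (Fin (N - 1)) :=
    (Ici 0).indicator fun s => (Q * lap (G (σ s)) * Qᵀ).l2CLM with hMdef
  have hMeq : ∀ s, 0 ≤ s → M s = (Q * lap (G (σ s)) * Qᵀ).l2CLM := fun s hs =>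
    indicator_of_mem (mem_Ici.2 hs) _
  have hMapply : ∀ s, 0 ≤ s → ∀ y, M s y = Q.l2CLM ((lap (G (σ s))).l2CLM (Qᵀ.l2CLM y)) :=
    fun s hs y => by rw [hMeq s hs, Matrix.l2CLM_mul_apply, Matrix.l2CLM_mul_apply]
  have hMpos : ∀ d, 0 ≤ d → IntervalIntegrable M volume 0 d := fun d hd => by
    refine (hσ.intervalIntegrable (h := fun c _ => (Q * lap (G c) * Qᵀ).l2CLM) le_rfl hd
      fun _ => by simp).congr fun s hs => ?_
    rw [uIoc_of_le hd] at hs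
    exact (hMeq s hs.1.le).symm
  have hMneg : ∀ d, d ≤ 0 → IntervalIntegrable M volume 0 d := fun d hd => by
    rw [intervalIntegrable_iff, uIoc_of_ge hd, integrableOn_Ioc_iff_integrableOn_Ioo]
    refine IntegrableOn.congr_fun integrableOn_zero (fun s hs => ?_) measurableSet_Ioo
    exact (indicator_of_notMem (by simpa using hs.2) _).symm
  have hM0 : ∀ d, IntervalIntegrable M volume 0 d := fun d =>
    (le_total 0 d).elim (hMpos d) (hMneg d)
  have hM : ∀ a b, IntervalIntegrable M volume a b := fun a b => (hM0 a).symm.trans (hM0 b)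
  have hMK : ∀ s, ‖M s‖ ≤ K := fun s => by
    rcases le_or_gt 0 s with hs | hs
    · refine ContinuousLinearMap.opNorm_le_bound _ hK0 fun y => ?_
      rw [hMapply s hs]
      exact (hQ.norm_le _).trans ((hKa _ _).trans_eq (by rw [hQ.norm_transpose]))
    · rw [hMdef, indicator_of_notMem (by simpa using hs), norm_zero]
      exact hK0
  have hMPE : ∀ t, t₀ ≤ t → ∀ y, T * μ * ‖y‖ ^ 2 ≤ inner ℝ y ((∫ s in t..(t + T), M s) y) :=
    fun t ht y => by
      refine (hPE.le_inner hσ hT (ht₀.trans ht) y).trans_eq ?_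
      congr 2
      refine intervalIntegral.integral_congr fun s hs => (hMeq s ?_).symm
      rw [uIcc_of_le (by linarith)] at hs
      linarith [hs.1]
  set Lχ : EuclideanSpace ℝ (Fin N ⊕ Fin N) →L[ℝ] EuclideanSpace ℝ (Fin (N - 1)) :=
    γ • Q.l2CLM ∘L pos + Q.l2CLM ∘L vel with hLχ
  have hac := hx.absolutelyContinuousOnInterval hσ hp hu ht₀ hc
  set f : ℝ → EuclideanSpace ℝ (Fin N ⊕ Fin N) := fun s =>
    WithLp.toLp 2 (sysA α γ (G (σ s)) *ᵥ (x s).ofLp + sysB 𝒜 *ᵥ (u s).ofLp)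
  have hfp : ∀ s, pos (f s) = vel (x s) := fun s => pos_vectorField _ _ _
  have hfv : ∀ s, vel (f s) = -(α • (lap (G (σ s))).l2CLM (pos (x s))) - γ • vel (x s)
      + attack 𝒜 (u s) := fun s => vel_vectorField _ _ _
  -- In terms of `χ`, the Laplacian feedback is `α L p̃ = (α/γ) (L Qᵀ χ - L v)`.
  have hfeed : ∀ s, α • (lap (G (σ s))).l2CLM (pos (x s)) = (α / γ) •
      ((lap (G (σ s))).l2CLM (Qᵀ.l2CLM (Lχ (x s))) - (lap (G (σ s))).l2CLM (vel (x s))) :=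
    fun s => by
      have : Lχ (x s) = γ • Q.l2CLM (pos (x s)) + Q.l2CLM (vel (x s)) := rfl
      rw [this, map_add, map_add, map_smul, map_smul, hQ.lap_apply, hQ.lap_apply,
        add_sub_cancel_right, smul_smul, div_mul_cancel₀ _ hγ.ne']
  refine norm_sq_add_norm_sq_le_of_persistently_exciting (χ := fun t => Lχ (x t))
    (χ' := fun t => Lχ (f t)) (v := fun t => vel (x t)) (v' := fun t => vel (f t))
    hM hMK (by positivity) hμ hT hb0 hMPE h1 h2 h3 hc (hac.clm_comp Lχ) (hac.clm_comp vel)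
    ?_ (fun t ht => ?_) (fun t ht => ?_)
  · filter_upwards [hx.ae_hasDerivAt hσ hp hu ht₀ hc] with t ht htm
    exact ⟨Lχ.hasFDerivAt.comp_hasDerivAt t (ht htm), vel.hasFDerivAt.comp_hasDerivAt t (ht htm)⟩
  · have e : Lχ (f t) + (α / γ) • M t (Lχ (x t))
        = (α / γ) • Q.l2CLM ((lap (G (σ t))).l2CLM (vel (x t))) + Q.l2CLM (attack 𝒜 (u t)) := by
      have : Lχ (f t) = γ • Q.l2CLM (pos (f t)) + Q.l2CLM (vel (f t)) := rfl
      rw [this, hfp, hfv, hfeed, hMapply t (ht₀.trans ht.1.le)]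
      simp only [map_add, map_sub, map_neg, map_smul, smul_sub]
      abel
    rw [e]
    refine (norm_add_le _ _).trans (add_le_add ?_ ?_)
    · rw [norm_smul, Real.norm_of_nonneg (by positivity), mul_assoc]
      gcongr
      exact (hQ.norm_le _).trans (hKa _ _)
    · exact (hQ.norm_le _).trans ((norm_attack _).trans_le (hb t ht))
  · have i1 : |inner ℝ (vel (x t)) ((lap (G (σ t))).l2CLM (Qᵀ.l2CLM (Lχ (x t))))|
        ≤ ‖vel (x t)‖ * (K * ‖Lχ (x t)‖) := (abs_real_inner_le_norm _ _).trans (by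
      gcongr
      exact (hKa _ _).trans_eq (by rw [hQ.norm_transpose]))
    have i2 : inner ℝ (vel (x t)) ((lap (G (σ t))).l2CLM (vel (x t)))
        ≤ ‖vel (x t)‖ * (K * ‖vel (x t)‖) := (real_inner_le_norm _ _).trans (by
      gcongr
      exact hKa _ _)
    have i3 : inner ℝ (vel (x t)) (attack 𝒜 (u t)) ≤ ‖vel (x t)‖ * b :=
      (real_inner_le_norm _ _).trans (by gcongr; exact (norm_attack _).trans_le (hb t ht))
    have hε : 0 ≤ α / γ := by positivity
    have j1 := mul_le_mul_of_nonneg_left (neg_le.1 (abs_le.1 i1).1) hε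
    have j2 := mul_le_mul_of_nonneg_left i2 hε
    rw [hfv, hfeed, inner_add_right, inner_sub_right, inner_neg_right, inner_smul_right,
      inner_smul_right, inner_sub_right, real_inner_self_eq_norm_sq]
    linarith

/-- All smallness conditions hold for large `γ`, because they are satisfied in the limit
`α / γ → 0`. -/
theorem exists_gain_threshold (K α μ T : ℝ) (hμ : 0 < μ) :
    ∃ γ₀ : ℝ, 0 < γ₀ ∧ ∀ γ, γ₀ ≤ γ → 2 * K ≤ γ ∧ K * μ ≤ γ ∧ α / γ * K * T ≤ 1 / 8 ∧
      16 * (α / γ * K * T) * K ≤ μ ∧ α / γ * K + 13 * (α / γ) * K ^ 2 / μ + α / γ * μ ≤ γ := by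
  have hlim : Tendsto (fun γ : ℝ => α / γ) atTop (𝓝 0) := tendsto_const_nhds.div_atTop tendsto_id
  have l1 : Tendsto (fun γ : ℝ => α / γ * K * T) atTop (𝓝 0) := by
    simpa using (hlim.mul_const K).mul_const T
  have l2 : Tendsto (fun γ : ℝ => 16 * (α / γ * K * T) * K) atTop (𝓝 0) := by
    simpa using (l1.const_mul 16).mul_const K
  have l3 : Tendsto (fun γ : ℝ => α / γ * K + 13 * (α / γ) * K ^ 2 / μ + α / γ * μ) atTop
      (𝓝 0) := by
    simpa using ((hlim.mul_const K).add (((hlim.const_mul 13).mul_const (K ^ 2)).div_const μ)).add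
      (hlim.mul_const μ)
  obtain ⟨γ₁, h⟩ := eventually_atTop.1 ((eventually_ge_atTop (2 * K)).and
    ((eventually_ge_atTop (K * μ)).and ((l1.eventually_le_const (by norm_num : (0 : ℝ) < 1 / 8)).and
    ((l2.eventually_le_const hμ).and ((l3.eventually_le_const one_pos).and
    (eventually_ge_atTop 1))))))
  refine ⟨max γ₁ 1, by positivity, fun γ hγ => ?_⟩
  obtain ⟨a1, a2, a3, a4, a5, a6⟩ := h γ ((le_max_left _ _).trans hγ)
  exact ⟨a1, a2, a3, a4, a5.trans a6⟩

/-- The coupling term is controlled by `Q p̃ = (χ - Q v) / γ`. -/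
theorem norm_rho_le_of_norm_sq_le {N : ℕ} {α γ K A B : ℝ} {Q : Matrix (Fin (N - 1)) (Fin N) ℝ}
    (hα : 0 ≤ α) (hγ : 0 < γ) (hK0 : 0 ≤ K) (hA : 0 ≤ A) (hB : 0 ≤ B)
    (hK : ∀ H : SimpleGraph (Fin N), ‖(lap H).l2CLM‖ ≤ K)
    (hQ : IsReduction Q) (H : SimpleGraph (Fin N)) (i : Fin N)
    (y : EuclideanSpace ℝ (Fin N ⊕ Fin N))
    (h : 2 * (‖γ • Q.l2CLM (pos y) + Q.l2CLM (vel y)‖ ^ 2 + ‖vel y‖ ^ 2) ≤ A ^ 2 + B ^ 2) :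
    ‖rho α H i (stateI H i y) (stateR H i y)‖ ≤ α * (K * ((A + B) / γ)) := by
  refine (norm_rho_le hα H i y).trans (mul_le_mul_of_nonneg_left ?_ hα)
  rw [← hQ.lap_apply]
  refine ((lap _).l2CLM.le_of_opNorm_le (hK _) _).trans (mul_le_mul_of_nonneg_left ?_ hK0)
  rw [hQ.norm_transpose, le_div_iff₀ hγ]
  set χ := γ • Q.l2CLM (pos y) + Q.l2CLM (vel y) with hχ
  have e : γ • Q.l2CLM (pos y) = χ - Q.l2CLM (vel y) := by simp [hχ]
  have h1 : ‖Q.l2CLM (pos y)‖ * γ ≤ ‖χ‖ + ‖vel y‖ := by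
    have := norm_sub_le χ (Q.l2CLM (vel y))
    rw [← e, norm_smul, Real.norm_of_nonneg hγ.le] at this
    linarith [hQ.norm_le (vel y)]
  refine h1.trans (le_of_sq_le_sq ?_ (by positivity))
  nlinarith [sq_nonneg (‖χ‖ - ‖vel y‖), mul_nonneg hA hB]

end MultiAgent

theorem proposition3 (N : ℕ) (hN : 3 ≤ N) (α μ T : ℝ) (hα : 0 < α)
    (hμ : 0 < μ) (hμN : μ ≤ N) (hT : 0 < T) :
    -- "sufficiently large" control gain, with a threshold depending only on `N, α, μ, T`
    ∃ γ₀ : ℝ, 0 < γ₀ ∧ ∀ γ : ℝ, γ₀ ≤ γ →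
    ∀ (β lamX : ℝ), 0 < β → 0 < lamX → lamX < MultiAgent.lamChi N α γ μ T →
    ∀ (Q : Matrix (Fin (N - 1)) (Fin N) ℝ), MultiAgent.IsReduction Q →
    ∀ (q : ℕ) (G : Fin q → SimpleGraph (Fin N)) (σ : ℝ → Fin q),
      MultiAgent.FiniteSwitching σ → MultiAgent.PEConnected G σ Q μ T →
    ∀ (𝒜 : Finset (Fin N)) (p : ℝ≥0∞) (u : ℝ → EuclideanSpace ℝ 𝒜),
      1 ≤ p → MultiAgent.MemLpe p u →
    ∀ (t₀ : ℝ) (x : ℝ → EuclideanSpace ℝ (Fin N ⊕ Fin N)), 0 ≤ t₀ →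
      MultiAgent.IsTrajectory α γ G σ 𝒜 u t₀ x →
    ∀ i : Fin N,
      (∀ Td : ℝ, BddAbove ((fun s => ‖u s‖) '' Set.Icc t₀ Td) →
        ∀ t : ℝ, t₀ ≤ t → t ≤ Td →
          ‖MultiAgent.rho α (G (σ t)) i (MultiAgent.stateI (G (σ t)) i (x t))
              (MultiAgent.stateR (G (σ t)) i (x t))‖
            ≤ α * MultiAgent.kappaX α γ μ T β Q * Real.exp (-lamX * (t - t₀)) * ‖x t₀‖
              + α * MultiAgent.kappaU α γ μ T β lamX Q *
                sSup ((fun s => ‖u s‖) '' Set.Icc t₀ Td)) ∧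
      (𝒜 = ∅ →
        (∀ t : ℝ, t₀ ≤ t →
          ‖MultiAgent.rho α (G (σ t)) i (MultiAgent.stateI (G (σ t)) i (x t))
              (MultiAgent.stateR (G (σ t)) i (x t))‖
            ≤ α * MultiAgent.kappaX α γ μ T β Q * Real.exp (-lamX * (t - t₀)) * ‖x t₀‖) ∧
        Tendsto (fun t =>
          ‖MultiAgent.rho α (G (σ t)) i (MultiAgent.stateI (G (σ t)) i (x t))
              (MultiAgent.stateR (G (σ t)) i (x t))‖) atTop (𝓝 0)) := by
  obtain ⟨K, hK0, hK⟩ := MultiAgent.exists_norm_lap_le N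
  obtain ⟨γ₀, hγ₀, hlarge⟩ := MultiAgent.exists_gain_threshold K α μ T hμ
  refine ⟨γ₀, hγ₀, fun γ hγ β lamX hβ hlam0 hlam Q hQ q G σ hσ hPE 𝒜 p u hp hu t₀ x ht₀ hx i => ?_⟩
  obtain ⟨g1, g2, g3, g4, g5⟩ := hlarge γ hγ
  have hγ0 : 0 < γ := hγ₀.trans_le hγ
  have hN0 : 0 < N := by omega
  have hN1 : (1 : ℝ) ≤ N := by exact_mod_cast hN0
  have hε : 0 < α / γ := by positivity
  have hlχ := MultiAgent.lamChi_le hα hγ0 hμ hμN hT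
  have hkx := MultiAgent.le_kappaX (μ := μ) (T := T) hN0 hα hγ0 hβ Q
  have hku := MultiAgent.le_kappaU hN0 hα hγ0 hμ hμN hT hβ hlam0 hlam Q
  have main : ∀ Td : ℝ, BddAbove ((fun s => ‖u s‖) '' Set.Icc t₀ Td) →
        ∀ t : ℝ, t₀ ≤ t → t ≤ Td →
          ‖MultiAgent.rho α (G (σ t)) i (MultiAgent.stateI (G (σ t)) i (x t))
              (MultiAgent.stateR (G (σ t)) i (x t))‖
            ≤ α * MultiAgent.kappaX α γ μ T β Q * Real.exp (-lamX * (t - t₀)) * ‖x t₀‖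
              + α * MultiAgent.kappaU α γ μ T β lamX Q *
                sSup ((fun s => ‖u s‖) '' Set.Icc t₀ Td) := by
    intro Td hbdd t ht htd
    set b := sSup ((fun s => ‖u s‖) '' Set.Icc t₀ Td)
    have hb : ∀ s ∈ Icc t₀ Td, ‖u s‖ ≤ b := fun s hs => le_csSup hbdd ⟨s, hs, rfl⟩
    have hb0 : 0 ≤ b := (norm_nonneg _).trans (hb t ⟨ht, htd⟩)
    have hdec := hx.norm_sq_le hα hγ0 hμ hT hK0 hK hQ hσ hPE hp hu g3 g4 g5 ht₀ ht hb0
      fun s hs => hb s ⟨hs.1.le, hs.2.le.trans htd⟩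
    have hinit := MultiAgent.norm_sq_add_le_opNorm_inv hγ0.ne' hQ (x t₀)
    set D := MultiAgent.opNorm ((MultiAgent.matC γ Q)⁻¹) * ‖x t₀‖
    have hD : 0 ≤ D := mul_nonneg (norm_nonneg _) (norm_nonneg _)
    -- The decay rate `εμ` of the squared norm is at least `2 λ_χ`.
    have hexp : Real.exp (-(α / γ * μ) * (t - t₀)) ≤ Real.exp (-lamX * (t - t₀)) ^ 2 := by
      rw [← Real.exp_nat_mul]
      refine Real.exp_le_exp.2 ?_
      have := mul_nonneg (sub_nonneg.2 ht) (show 0 ≤ α / γ * μ - 2 * lamX by linarith)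
      push_cast
      linarith
    have hle : 2 * Real.exp (-(α / γ * μ) * (t - t₀)) *
        (‖γ • Q.l2CLM (MultiAgent.pos (x t₀)) + Q.l2CLM (MultiAgent.vel (x t₀))‖ ^ 2
          + ‖MultiAgent.vel (x t₀)‖ ^ 2) ≤ 2 * Real.exp (-lamX * (t - t₀)) ^ 2 * D ^ 2 := by
      gcongr
    have hρ := MultiAgent.norm_rho_le_of_norm_sq_le hα.le hγ0 hK0
      (A := 2 * Real.exp (-lamX * (t - t₀)) * D) (B := 8 * (b / (α / γ * μ))) (by positivity)
      (by positivity) hK hQ (G (σ t)) i (x t) (by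
        have := sq_nonneg (b / (α / γ * μ))
        nlinarith)
    refine hρ.trans ?_
    have p1 : K * (2 * Real.exp (-lamX * (t - t₀)) * D / γ)
        ≤ MultiAgent.kappaX α γ μ T β Q * Real.exp (-lamX * (t - t₀)) * ‖x t₀‖ := by
      calc _ = 2 * K / γ * (Real.exp (-lamX * (t - t₀)) * D) := by ring
        _ ≤ 1 * (Real.exp (-lamX * (t - t₀)) * D) := by
          gcongr
          exact (div_le_one hγ0).2 g1
        _ = MultiAgent.opNorm ((MultiAgent.matC γ Q)⁻¹) * Real.exp (-lamX * (t - t₀)) * ‖x t₀‖ := by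
          ring
        _ ≤ _ := by gcongr
    have p2 : K * (8 * (b / (α / γ * μ)) / γ) ≤ MultiAgent.kappaU α γ μ T β lamX Q * b := by
      calc _ = 8 * 1 * (K * μ) / (α * μ ^ 2) * b := by field_simp
        _ ≤ 8 * N * γ / (α * μ ^ 2) * b := by gcongr
        _ ≤ _ := by gcongr
    calc _ = α * (K * (2 * Real.exp (-lamX * (t - t₀)) * D / γ)
          + K * (8 * (b / (α / γ * μ)) / γ)) := by ring
      _ ≤ α * (MultiAgent.kappaX α γ μ T β Q * Real.exp (-lamX * (t - t₀)) * ‖x t₀‖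
          + MultiAgent.kappaU α γ μ T β lamX Q * b) := by gcongr
      _ = _ := by ring
  refine ⟨main, fun h𝒜 => ?_⟩
  subst h𝒜
  have hu0 : ∀ s, ‖u s‖ = 0 := fun s => by rw [Subsingleton.elim (u s) 0, norm_zero]
  have hfree : ∀ t : ℝ, t₀ ≤ t →
      ‖MultiAgent.rho α (G (σ t)) i (MultiAgent.stateI (G (σ t)) i (x t))
          (MultiAgent.stateR (G (σ t)) i (x t))‖
        ≤ α * MultiAgent.kappaX α γ μ T β Q * Real.exp (-lamX * (t - t₀)) * ‖x t₀‖ := by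
    intro t ht
    have hset : (fun s => ‖u s‖) '' Set.Icc t₀ t = {0} := by
      simp only [hu0]
      exact (nonempty_Icc.2 ht).image_const 0
    simpa [hset] using main t (by rw [hset]; exact bddAbove_singleton) t ht le_rfl
  refine ⟨hfree, squeeze_zero' (.of_forall fun _ => norm_nonneg _)
    ((eventually_ge_atTop t₀).mono hfree) ?_⟩
  have hlin : Tendsto (fun t : ℝ => -lamX * (t - t₀)) atTop atBot :=
    (tendsto_id.atTop_add tendsto_const_nhds).const_mul_atTop_of_neg (neg_lt_zero.2 hlam0)
  simpa using ((Real.tendsto_exp_atBot.comp hlin).const_mul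
    (α * MultiAgent.kappaX α γ μ T β Q)).mul_const ‖x t₀‖
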